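/- Let $V$ be a finite set, let $G,H$ be simple undirected graphs with vertex set $V$, and let $k\ge 1$. **Sherali–Adams relaxations.** Let $\mathcal T_{G,H}$ be the set of $X\in[0,1]^{V\times V}$ with $\sum_w X_{uw}=1$, $\sum_w X_{wv}=1$ and $\sum_{w\in\delta_H(v)}X_{uw}=\sum_{w\in\delta_G(u)}X_{wv}$ for all $u,v\in V$, where $\delta_G(u)$ is the set of neighbours of $u$ in $G$; put $\mathcal T_G=\mathcal T_{G,G}$. The extended formulation $\hat{\mathcal T}^k_{G,H}$ consists of the vectors $Y=(Y_I)$ with $Y_\emptyset=1$ that satisfy the linearizations (replace $X_{uv}^2$ by $X_{uv}$, then each square-free monomial $\prod_{(u,v)\in I}X_{uv}$ by $Y_I$) of $\prod_{(u,v)\in I}X_{uv}\cdot f(X)=0$ for all $|I|\le k-1$ and all of these equations $f=0$, and of $\prod_{(u,v)\in I}X_{uv}\prod_{(u,v)\in J\setminus I}(1-X_{uv})\ge 0$ for all $I\subseteq J\subseteq V^2$, $|J|\le k$. The $k$-th Sherali–Adams relaxation $\mathcal T^k_{G,H}$ is its projection $X_{uv}=Y_{\{(u,v)\}}$; $\mathcal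 T^k_G=\mathcal T^k_{G,G}$. **The $k$-dimensional generalized vertex classification ($k$-dim C-V-C) algorithm.** For $u\in V^k$ let $\delta^i_G(u)$ (respectively $\bar\delta^i_G(u)$) be the set of tuples obtained from $u$ by replacing $u_i$ with a neighbour (respectively a non-neighbour, including $u_i$ itself) of $u_i$ in $G$. Fix $\sigma_1,\sigma_2$ generating the symmetric group $S_k$, acting on tuples by $\sigma(u)_i=u_{\sigma(i)}$. For a partition $\pi$ of $V^k$ put $(G,\pi,u)\equiv_\delta(G,\pi,v)$ if: $u$ and $v$ lie in the same cell of $\pi$; $|\delta^i_G(u)\cap C|=|\delta^i_G(v)\cap C|$ and $|\bar\delta^i_G(u)\cap C|=|\bar\delta^i_G(v)\cap C|$ for every cell $C$ of $\pi$ and all $i$; for all $i,j$, $u_i=u_j\Leftrightarrow v_i=v_j$ and $\{u_i,u_j\}\in E_G\Leftrightarrow\{v_i,v_j\}\in E_G$; and $\sigma_r(u),\sigma_r(v)$ lie in the same cell of $\pi$ for $r=1,2$. Let $\delta_G(\pi)$ be the resulting refinement and $\delta^*_G(\pi)$ the fixed point reached by iterating $\delta_G$ from $\pi$. The algorithm *declares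 $G$ asymmetric* if all cells of $\delta^*_G(\{V^k\})$ are singletons. For an ordered partition $\vec\pi=(\vec\pi_1,\dots,\vec\pi_m)$ of $V^k$ let $[u]_{\vec\pi}$ be the index of the cell of $u$. The $\vec\delta$ preorder compares triples $(G,\vec\pi,u)$ lexicographically by: $[u]_{\vec\pi}$; $([\sigma_1(u)]_{\vec\pi},[\sigma_2(u)]_{\vec\pi})$; the $k\times k$ matrix with $(i,j)$ entry $0$ if $u_i=u_j$, $1$ if $\{u_i,u_j\}\in E_G$ and $-1$ otherwise; and, for $i=1,\dots,k$, the vector of the numbers $|\delta^i_G(u)\cap\vec\pi_1|,\dots,|\delta^i_G(u)\cap\vec\pi_m|,|\bar\delta^i_G(u)\cap\vec\pi_1|,\dots,|\bar\delta^i_G(u)\cap\vec\pi_m|$ (vectors of different lengths are compared in dictionary order). Write $\equiv_{\vec\delta}$ for equivalence in this preorder, $\vec\delta_G(\vec\pi)$ for the ordered partition it induces on $V^k$ for fixed $(G,\vec\pi)$, and $\vec\delta^*_G(\vec\pi)$ for the fixed point reached by iteration. Write $(G,\vec\pi)\equiv_{\vec\delta}(H,\vec\tau)$ if $\vec\delta_G(\vec\pi)$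 and $\vec\delta_H(\vec\tau)$ have equally many cells, of the same sizes in order, and $(G,\vec\pi,u)\equiv_{\vec\delta}(H,\vec\tau,v)\Leftrightarrow[u]_{\vec\delta_G(\vec\pi)}=[v]_{\vec\delta_H(\vec\tau)}$ for all $u,v\in V^k$. The algorithm *declares $G$ and $H$ non-isomorphic* if $(G,\vec\delta^*_G((V^k)))\not\equiv_{\vec\delta}(H,\vec\delta^*_H((V^k)))$. **Partition polytopes.** For $u,v\in V^k$ put $\langle u,v\rangle=\{(u_1,v_1),\dots,(u_k,v_k)\}$. Let $P(\pi)$ be the set of $Y\in P$ with $Y_{\langle u,v\rangle}=0$ whenever $u,v$ lie in different cells of $\pi$, and $P(\vec\pi,\vec\tau)$ the set of $Y\in P$ with $Y_{\langle u,v\rangle}=0$ whenever $[u]_{\vec\pi}\ne[v]_{\vec\tau}$. **Theorem.** 1. $\mathcal T^k_G=\{\mathcal I\}$, where $\mathcal I$ is the identity matrix, if and only if the $k$-dim C-V-C algorithm declares $G$ asymmetric. 2. $\mathcal T^k_{G,H}=\emptyset$ if and only if the $k$-dim C-V-C algorithm declares $G$ and $H$ non-isomorphic. 3. $\delta$ and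 $P=\hat{\mathcal T}^k_{G,G}$ are combinatorially equivalent: for every partition $\pi$ of $V^k$ and all $u,v\in V^k$, $(G,\delta^*_G(\pi),u)\not\equiv_\delta(G,\delta^*_G(\pi),v)$ if and only if $Y_{\langle u,v\rangle}=0$ for all $Y\in P(\pi)$. 4. $\vec\delta$ and $P=\hat{\mathcal T}^k_{G,H}$ are combinatorially equivalent: for all ordered partitions $\vec\pi,\vec\tau$ of $V^k$, (a) if $(G,\vec\pi,u)\not\equiv_{\vec\delta}(H,\vec\tau,v)$, then $Y_{\langle u,v\rangle}=0$ for all $Y\in P(\vec\pi,\vec\tau)$; (b) if $\vec\delta_G(\vec\pi)=\vec\pi$, $\vec\delta_H(\vec\tau)=\vec\tau$ and $(G,\vec\pi)\equiv_{\vec\delta}(H,\vec\tau)$, then $P(\vec\pi,\vec\tau)\ne\emptyset$, and for all $u,v\in V^k$ with $(G,\vec\pi,u)\equiv_{\vec\delta}(H,\vec\tau,v)$ there is $Y\in P(\vec\pi,\vec\tau)$ with $Y_{\langle u,v\rangle}\ne0$. -/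

import Mathlib

noncomputable section

open MvPolynomial

/-! # Sherali–Adams relaxations -/

/-- Square-free linearization: every monomial `∏ x_i ^ m_i` is first replaced by the square-free
monomial on its support and then by the variable `Y_I`, where `I` is that support. -/
def linearize {σ : Type*} (Y : Finset σ → ℝ) (p : MvPolynomial σ ℝ) : ℝ :=
  ∑ m ∈ p.support, p.coeff m * Y m.support

/-- The extended formulation of the `k`-th Sherali–Adams relaxation of
`{x ∈ [0,1]^σ : f x = 0 for f ∈ eqs, 0 ≤ g x for g ∈ ineqs}`. A point is a vector `Y` of variables
`Y_I`, with `Y_∅ = 1`. Variables `Y_I` that occur in no linearized constraint are left free; they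
play no role in the projection. -/
def sheraliAdamsExt {σ : Type*} [DecidableEq σ] (eqs ineqs : Set (MvPolynomial σ ℝ)) (k : ℕ) :
    Set (Finset σ → ℝ) :=
  {Y | Y ∅ = 1 ∧
    (∀ f ∈ eqs, ∀ I : Finset σ, I.card + 1 ≤ k → linearize Y ((∏ i ∈ I, X i) * f) = 0) ∧
    (∀ g ∈ ineqs, ∀ I J : Finset σ, I ⊆ J → J.card + 1 ≤ k →
      0 ≤ linearize Y ((∏ i ∈ I, X i) * (∏ i ∈ J \ I, (1 - X i)) * g)) ∧
    (∀ I J : Finset σ, I ⊆ J → J.card ≤ k →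
      0 ≤ linearize Y ((∏ i ∈ I, X i) * ∏ i ∈ J \ I, (1 - X i)))}

/-- The `k`-th Sherali–Adams relaxation: the projection of the extended formulation to the
variables `x_i = Y_{i}`. -/
def sheraliAdams {σ : Type*} [DecidableEq σ] (eqs ineqs : Set (MvPolynomial σ ℝ)) (k : ℕ) :
    Set (σ → ℝ) :=
  {x | ∃ Y ∈ sheraliAdamsExt eqs ineqs k, ∀ i, x i = Y {i}}

/-! # The Tinhofer polytope -/

section Tinhofer

variable {V : Type*} [Fintype V] [DecidableEq V]

open Classical in
/-- The equations of the Tinhofer polytope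
`{X ∈ [0,1]^{V × V} : X e = Xᵀ e = e, X A_H = A_G X}` as polynomials in the variables `X_{uv}`
(rows are vertices of `G`, columns vertices of `H`, so that the permutation matrix with
`X_{uv} = 1` iff `ψ u = v` satisfies them iff `ψ` is an isomorphism from `G` to `H`). -/
def tinhoferEqs (G H : SimpleGraph V) : Set (MvPolynomial (V × V) ℝ) :=
  {f | ∃ u, f = (∑ w : V, X (u, w)) - 1} ∪
  {f | ∃ v, f = (∑ w : V, X (w, v)) - 1} ∪
  {f | ∃ u v, f = (∑ w : V with H.Adj v w, X (u, w)) - ∑ w : V with G.Adj u w, X (w, v)}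

/-- The extended formulation of the `k`-th Sherali–Adams relaxation of the Tinhofer polytope. -/
def tinhoferExt (k : ℕ) (G H : SimpleGraph V) : Set (Finset (V × V) → ℝ) :=
  sheraliAdamsExt (tinhoferEqs G H) ∅ k

/-- The `k`-th Sherali–Adams relaxation of the Tinhofer polytope, as a set of matrices. -/
def tinhoferSA (k : ℕ) (G H : SimpleGraph V) : Set (Matrix V V ℝ) :=
  {M | (fun p : V × V => M p.1 p.2) ∈ sheraliAdams (tinhoferEqs G H) ∅ k}

end Tinhofer

/-! # Tuples of vertices -/

section Tuples

variable {V : Type*} {k : ℕ}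

/-- The tuples obtained from `u` by replacing `u i` by a neighbour of `u i`. -/
def nbrTuples (G : SimpleGraph V) (i : Fin k) (u : Fin k → V) : Set (Fin k → V) :=
  {x | ∃ w, G.Adj (u i) w ∧ x = Function.update u i w}

/-- The tuples obtained from `u` by replacing `u i` by a vertex that is not a neighbour of `u i`
(possibly `u i` itself). -/
def nonNbrTuples (G : SimpleGraph V) (i : Fin k) (u : Fin k → V) : Set (Fin k → V) :=
  {x | ∃ w, ¬ G.Adj (u i) w ∧ x = Function.update u i w}

/-- The set of pairs `{(u_1, v_1), …, (u_k, v_k)}`. -/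
def pairSet [DecidableEq V] (u v : Fin k → V) : Finset (V × V) :=
  Finset.univ.image fun i => (u i, v i)

end Tuples

/-- The point reached by applying `F` to `x` until the value no longer changes. -/
def iterateUntilStable {α : Type*} (F : α → α) (x : α) : α :=
  F^[sInf {r : ℕ | F^[r + 1] x = F^[r] x}] x

/-! # The automorphism algorithm

Partitions of the set of `k`-tuples are given as equivalence relations; `⊤` is the trivial
partition and `⊥` the complete one. The permutations `σ₁, σ₂` are to generate the symmetric group. -/

section Automorphism

variable {V : Type*} {k : ℕ}

/-- `u` and `v` span the same ordered subgraph of `G`. -/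
def SameType (G : SimpleGraph V) (u v : Fin k → V) : Prop :=
  ∀ i j, (u i = u j ↔ v i = v j) ∧ (G.Adj (u i) (u j) ↔ G.Adj (v i) (v j))

/-- The vertex classification equivalence relation `(G, π, u) ≡_δ (G, π, v)`. -/
def deltaEquiv (σ₁ σ₂ : Equiv.Perm (Fin k)) (G : SimpleGraph V) (π : Setoid (Fin k → V))
    (u v : Fin k → V) : Prop :=
  (π u v ∧ ∀ s ∈ π.classes, ∀ i : Fin k,
    (nbrTuples G i u ∩ s).ncard = (nbrTuples G i v ∩ s).ncard ∧
    (nonNbrTuples G i u ∩ s).ncard = (nonNbrTuples G i v ∩ s).ncard) ∧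
  SameType G u v ∧
  (π (u ∘ σ₁) (v ∘ σ₁) ∧ π (u ∘ σ₂) (v ∘ σ₂))

/-- One refinement step `π ↦ δ_G(π)`. -/
def deltaRefine (σ₁ σ₂ : Equiv.Perm (Fin k)) (G : SimpleGraph V) (π : Setoid (Fin k → V)) :
    Setoid (Fin k → V) where
  r := deltaEquiv σ₁ σ₂ G π
  iseqv :=
    { refl := fun u => ⟨⟨π.refl u, fun _ _ _ => ⟨rfl, rfl⟩⟩, fun _ _ => ⟨Iff.rfl, Iff.rfl⟩,
        π.refl _, π.refl _⟩
      symm := fun h => ⟨⟨π.symm h.1.1, fun s hs i =>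
          ⟨(h.1.2 s hs i).1.symm, (h.1.2 s hs i).2.symm⟩⟩,
        fun i j => ⟨(h.2.1 i j).1.symm, (h.2.1 i j).2.symm⟩, π.symm h.2.2.1, π.symm h.2.2.2⟩
      trans := fun h h' => ⟨⟨π.trans h.1.1 h'.1.1, fun s hs i =>
          ⟨(h.1.2 s hs i).1.trans (h'.1.2 s hs i).1, (h.1.2 s hs i).2.trans (h'.1.2 s hs i).2⟩⟩,
        fun i j => ⟨(h.2.1 i j).1.trans (h'.2.1 i j).1, (h.2.1 i j).2.trans (h'.2.1 i j).2⟩,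
        π.trans h.2.2.1 h'.2.2.1, π.trans h.2.2.2 h'.2.2.2⟩ }

/-- The output `δ_G^*(π)` of the automorphism algorithm started at `π`. -/
def deltaStar (σ₁ σ₂ : Equiv.Perm (Fin k)) (G : SimpleGraph V) (π : Setoid (Fin k → V)) :
    Setoid (Fin k → V) :=
  iterateUntilStable (deltaRefine σ₁ σ₂ G) π

/-- The `k`-dimensional algorithm declares `G` asymmetric: the partition that it computes from the
trivial one is complete. -/
def DeclaresAsymmetric (σ₁ σ₂ : Equiv.Perm (Fin k)) (G : SimpleGraph V) : Prop :=
  deltaStar σ₁ σ₂ G ⊤ = ⊥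

/-- The partition polytope `P(π)`. -/
def partitionPolytope [DecidableEq V] (P : Set (Finset (V × V) → ℝ)) (π : Setoid (Fin k → V)) :
    Set (Finset (V × V) → ℝ) :=
  {Y | Y ∈ P ∧ ∀ u v : Fin k → V, ¬ π u v → Y (pairSet u v) = 0}

/-- Combinatorial equivalence, with respect to `G`, of a polyhedron `P` and the vertex
classification equivalence relation `δ`. -/
def CombEquivDelta [DecidableEq V] (σ₁ σ₂ : Equiv.Perm (Fin k)) (G : SimpleGraph V)
    (P : Set (Finset (V × V) → ℝ)) : Prop :=
  ∀ (π : Setoid (Fin k → V)) (u v : Fin k → V),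
    ¬ deltaEquiv σ₁ σ₂ G (deltaStar σ₁ σ₂ G π) u v ↔
      ∀ Y ∈ partitionPolytope P π, Y (pairSet u v) = 0

end Automorphism

/-! # Ordered partitions -/

/-- An ordered partition of `T`: `index u` is the number of the cell that contains `u`, where the
cells are numbered `0, 1, …, m - 1` and none of them is empty. -/
@[ext]
structure OrdPartition (T : Type*) where
  index : T → ℕ
  initial : ∀ u, ∀ j < index u, ∃ v, index v = j

namespace OrdPartition

variable {T : Type*}

/-- The `s`-th cell. -/
def cell (π : OrdPartition T) (s : ℕ) : Set T := {u | π.index u = s}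

/-- The number `m` of cells. -/
def size (π : OrdPartition T) : ℕ := (Set.range π.index).ncard

/-- The ordered partition with one cell. -/
def trivial (T : Type*) : OrdPartition T where
  index := fun _ => 0
  initial := fun _ j hj => absurd hj (Nat.not_lt_zero j)

/-- Two ordered partitions have equally many cells, of the same sizes in the same order. -/
def SameShape (π τ : OrdPartition T) : Prop :=
  π.size = τ.size ∧ ∀ s < π.size, (π.cell s).ncard = (τ.cell s).ncard

theorem exists_rank_eq {K : Type*} [LinearOrder K] (S : Finset K) (n : ℕ) :
    ∀ a ∈ S, {x ∈ S | x < a}.card = n → ∀ j < n, ∃ b ∈ S, {x ∈ S | x < b}.card = j := by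
  induction n with
  | zero => intro a _ _ j hj; omega
  | succ n ih =>
    intro a ha hn j hj
    have hne : (S.filter (· < a)).Nonempty := by rw [← Finset.card_pos]; omega
    obtain ⟨b, hb, hmax⟩ := Finset.exists_max_image _ id hne
    have hbS := (Finset.mem_filter.1 hb).1
    have hba := (Finset.mem_filter.1 hb).2
    have he : {x ∈ S | x < b} = {x ∈ S | x < a}.erase b := by
      ext x
      simp only [Finset.mem_filter, Finset.mem_erase]
      constructor
      · rintro ⟨hx, hxb⟩
        exact ⟨hxb.ne, hx, hxb.trans hba⟩
      · rintro ⟨hne', hx, hxa⟩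
        refine ⟨hx, lt_of_le_of_ne ?_ hne'⟩
        exact hmax x (Finset.mem_filter.2 ⟨hx, hxa⟩)
    have hcb : {x ∈ S | x < b}.card = n := by
      rw [he, Finset.card_erase_of_mem hb, hn]; rfl
    rcases Nat.lt_succ_iff_lt_or_eq.1 hj with h | h
    · exact ih b hbS hcb j h
    · exact ⟨b, hbS, h ▸ hcb⟩

/-- The ordered partition that belongs to the total preorder `f u ≤ f v`: the cells are the fibres
of `f`, in increasing order of the value of `f`. -/
def ofKey [Fintype T] {K : Type*} [LinearOrder K] (f : T → K) : OrdPartition T where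
  index := fun u => {x ∈ Finset.univ.image f | x < f u}.card
  initial := fun u j hj => by
    obtain ⟨b, hb, h⟩ := exists_rank_eq (Finset.univ.image f) _ (f u)
      (Finset.mem_image_of_mem f (Finset.mem_univ u)) rfl j hj
    obtain ⟨v, -, rfl⟩ := Finset.mem_image.1 hb
    exact ⟨v, h⟩

end OrdPartition

/-! # The isomorphism algorithm -/

section Isomorphism

variable {V : Type*} {k : ℕ}

open Classical in
/-- The entry of the combinatorial type matrix: `0` for equal vertices, `1` for adjacent ones and
`-1` otherwise. -/
def typeEntry (G : SimpleGraph V) (a b : V) : ℤ :=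
  if a = b then 0 else if G.Adj a b then 1 else -1

/-- The vector of the numbers of elements of `nbrTuples G i u` in the cells of `π`, followed by
those for `nonNbrTuples G i u`. -/
def degreeVector (G : SimpleGraph V) (π : OrdPartition (Fin k → V)) (i : Fin k) (u : Fin k → V) :
    List ℕ :=
  (List.range π.size).map (fun s => (nbrTuples G i u ∩ π.cell s).ncard) ++
  (List.range π.size).map (fun s => (nonNbrTuples G i u ∩ π.cell s).ncard)

/-- The values in which triples `(G, π, u)` are compared, ordered lexicographically. -/
abbrev DeltaKey (k : ℕ) : Type :=
  ℕ ×ₗ ((ℕ ×ₗ ℕ) ×ₗ (Lex (Fin k → Lex (Fin k → ℤ)) ×ₗ Lex (Fin k → List ℕ)))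

/-- The vertex classification preorder: `(G, π, u) ≤ (H, τ, v)` if and only if
`deltaKey σ₁ σ₂ G π u ≤ deltaKey σ₁ σ₂ H τ v`. The key consists of the index of the cell of `u`,
the indices of the cells of `σ₁(u), σ₂(u)`, the type matrix, and the degree vectors. -/
def deltaKey (σ₁ σ₂ : Equiv.Perm (Fin k)) (G : SimpleGraph V) (π : OrdPartition (Fin k → V))
    (u : Fin k → V) : DeltaKey k :=
  toLex (π.index u, toLex (toLex (π.index (u ∘ σ₁), π.index (u ∘ σ₂)),
    toLex (toLex fun i => toLex fun j => typeEntry G (u i) (u j),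
      toLex fun i => degreeVector G π i u)))

/-- Equivalence `(G, π, u) ≡ (H, τ, v)` in the vertex classification preorder. -/
def OrdDeltaEquiv (σ₁ σ₂ : Equiv.Perm (Fin k)) (G : SimpleGraph V) (π : OrdPartition (Fin k → V))
    (u : Fin k → V) (H : SimpleGraph V) (τ : OrdPartition (Fin k → V)) (v : Fin k → V) : Prop :=
  deltaKey σ₁ σ₂ G π u ≤ deltaKey σ₁ σ₂ H τ v ∧ deltaKey σ₁ σ₂ H τ v ≤ deltaKey σ₁ σ₂ G π u

variable [Fintype V]

/-- One refinement step for ordered partitions. -/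
def ordDeltaRefine (σ₁ σ₂ : Equiv.Perm (Fin k)) (G : SimpleGraph V)
    (π : OrdPartition (Fin k → V)) : OrdPartition (Fin k → V) :=
  OrdPartition.ofKey (deltaKey σ₁ σ₂ G π)

/-- The ordered partition at which refinement, started at `π`, becomes stable. -/
def ordDeltaStar (σ₁ σ₂ : Equiv.Perm (Fin k)) (G : SimpleGraph V)
    (π : OrdPartition (Fin k → V)) : OrdPartition (Fin k → V) :=
  iterateUntilStable (ordDeltaRefine σ₁ σ₂ G) π

/-- The equivalence `(G, π) ≡ (H, τ)` of graphs with ordered partitions. -/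
def OrdDeltaGraphEquiv (σ₁ σ₂ : Equiv.Perm (Fin k)) (G : SimpleGraph V)
    (π : OrdPartition (Fin k → V)) (H : SimpleGraph V) (τ : OrdPartition (Fin k → V)) : Prop :=
  (ordDeltaRefine σ₁ σ₂ G π).SameShape (ordDeltaRefine σ₁ σ₂ H τ) ∧
  ∀ u v, OrdDeltaEquiv σ₁ σ₂ G π u H τ v ↔
    (ordDeltaRefine σ₁ σ₂ G π).index u = (ordDeltaRefine σ₁ σ₂ H τ).index v

/-- The equivalence `(G, π) ≡ (H, τ)` for stable ordered partitions `π` and `τ`. -/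
def OrdDeltaStableEquiv (σ₁ σ₂ : Equiv.Perm (Fin k)) (G : SimpleGraph V)
    (π : OrdPartition (Fin k → V)) (H : SimpleGraph V) (τ : OrdPartition (Fin k → V)) : Prop :=
  ordDeltaRefine σ₁ σ₂ G π = π ∧ ordDeltaRefine σ₁ σ₂ H τ = τ ∧
  OrdDeltaGraphEquiv σ₁ σ₂ G π H τ

/-- The `k`-dimensional algorithm declares `G` and `H` non-isomorphic. -/
def DeclaresNonIsomorphic (σ₁ σ₂ : Equiv.Perm (Fin k)) (G H : SimpleGraph V) : Prop :=
  ¬ OrdDeltaGraphEquiv σ₁ σ₂ G (ordDeltaStar σ₁ σ₂ G (OrdPartition.trivial _))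
    H (ordDeltaStar σ₁ σ₂ H (OrdPartition.trivial _))

/-- The partition polytope `P(π, τ)`. -/
def ordPartitionPolytope [DecidableEq V] (P : Set (Finset (V × V) → ℝ))
    (π τ : OrdPartition (Fin k → V)) : Set (Finset (V × V) → ℝ) :=
  {Y | Y ∈ P ∧ ∀ u v : Fin k → V, π.index u ≠ τ.index v → Y (pairSet u v) = 0}

/-- Combinatorial equivalence, with respect to `(G, H)`, of a polyhedron `P` and the vertex
classification preorder `δ`. -/
def CombEquivOrdDelta [DecidableEq V] (σ₁ σ₂ : Equiv.Perm (Fin k)) (G H : SimpleGraph V)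
    (P : Set (Finset (V × V) → ℝ)) : Prop :=
  ∀ π τ : OrdPartition (Fin k → V),
    (∀ u v, ¬ OrdDeltaEquiv σ₁ σ₂ G π u H τ v →
      ∀ Y ∈ ordPartitionPolytope P π τ, Y (pairSet u v) = 0) ∧
    (OrdDeltaStableEquiv σ₁ σ₂ G π H τ →
      (ordPartitionPolytope P π τ).Nonempty ∧
      ∀ u v, OrdDeltaEquiv σ₁ σ₂ G π u H τ v →
        ∃ Y ∈ ordPartitionPolytope P π τ, Y (pairSet u v) ≠ 0)

end Isomorphism

end

/-! The argument follows the support of `Y`, i.e. the pairs of tuples with `Y (pairSet u v) ≠ 0`, in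
two directions.

Points respect refinement. Fix such a pair and let its `i`-th entries vary. The values `Y` at the
resulting pairs form a nonnegative matrix `M` with constant row and column sums and `M A_H = A_G M`,
a scaled fractional isomorphism. If `M` is supported on pairs in matching cells, a sum of squares
weighted by `M` vanishes, which forces equal degrees into every cell wherever `M a b ≠ 0`
(`fractionalIso_card_eq`). Equality and adjacency patterns agree by the row, column and adjacency
equations, so support pairs are equivalent after one more refinement step
(`IsTinhoferPoint.tupleMatch`). By iteration, a point of a partition polytope stays in the polytopes
of all later partitions.

Stable colourings give points. For stable colourings with equal class sizes (`Linked`), give `⟨u,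
v⟩` the weight one over the class size if `u` and `v` have the same colour, and `0` otherwise. This
depends only on the set of pairs because matching survives every reindexing of coordinates:
permutations come from the generators, and copying one entry to another is forced by the degree
conditions. Row and column sums follow by counting classes, the adjacency equations by double
counting edges between classes (`Linked.isTinhoferPoint`).

Together these determine which coordinates vanish on the partition polytopes at stable partitions.
The two statements about projections follow by starting from the trivial partition. -/

/-! ### Square-free linearization as a linear functional. -/

section Linearization

open MvPolynomial

variable {σ : Type*} (Y : Finset σ → ℝ)

theorem linearize_eq_sum {p : MvPolynomial σ ℝ} {S : Finset (σ →₀ ℕ)} (h : p.support ⊆ S) :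
    linearize Y p = ∑ m ∈ S, p.coeff m * Y m.support := by
  refine Finset.sum_subset h fun m _ hm => ?_
  rw [MvPolynomial.notMem_support_iff.1 hm, zero_mul]

/-- Square-free linearization as a linear functional. -/
def linearizeHom : MvPolynomial σ ℝ →ₗ[ℝ] ℝ where
  toFun := linearize Y
  map_add' p q := by
    classical
    rw [linearize_eq_sum Y (MvPolynomial.support_add (p := p) (q := q)),
      linearize_eq_sum Y (p := p) Finset.subset_union_left,
      linearize_eq_sum Y (p := q) (Finset.subset_union_right (s₁ := p.support)),
      ← Finset.sum_add_distrib]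
    exact Finset.sum_congr rfl fun m _ => by rw [coeff_add, add_mul]
  map_smul' c p := by
    rw [linearize_eq_sum Y (MvPolynomial.support_smul (a := c) (f := p)), linearize, RingHom.id_apply,
      smul_eq_mul, Finset.mul_sum]
    exact Finset.sum_congr rfl fun m _ => by rw [coeff_smul, smul_eq_mul, mul_assoc]

theorem linearizeHom_monomial (m : σ →₀ ℕ) (c : ℝ) :
    linearizeHom Y (monomial m c) = c * Y m.support := by
  classical
  change linearize Y _ = _
  rw [linearize_eq_sum Y (MvPolynomial.support_monomial_subset)]
  simp

/-- Exponents are natural numbers, so the support of a product of monomials is the union of the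
supports; linearization sees nothing else. -/
theorem linearizeHom_monomial_mul_congr {m n : σ →₀ ℕ} (h : m.support = n.support)
    (q : MvPolynomial σ ℝ) :
    linearizeHom Y (monomial m 1 * q) = linearizeHom Y (monomial n 1 * q) := by
  classical
  induction q using MvPolynomial.induction_on' with
  | monomial a c =>
    rw [monomial_mul, monomial_mul, linearizeHom_monomial, linearizeHom_monomial]
    congr 2
    ext i
    have := Finset.ext_iff.1 h i
    simp only [Finsupp.mem_support_iff] at this
    simp only [Finsupp.mem_support_iff, Finsupp.add_apply]
    omega
  | add p q hp hq => rw [mul_add, mul_add, map_add, map_add, hp, hq]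

theorem prod_X_eq_monomial (I : Finset σ) :
    (∏ i ∈ I, X i : MvPolynomial σ ℝ) = monomial (∑ i ∈ I, Finsupp.single i 1) 1 := by
  rw [MvPolynomial.monomial_sum_one]
  rfl

theorem support_sum_single (I : Finset σ) :
    (∑ i ∈ I, Finsupp.single i 1 : σ →₀ ℕ).support = I := by
  classical
  ext i
  simp [Finsupp.finsetSum_apply, Finsupp.single_apply]

theorem linearizeHom_prod_X (I : Finset σ) : linearizeHom Y (∏ i ∈ I, X i) = Y I := by
  rw [prod_X_eq_monomial, linearizeHom_monomial, support_sum_single, one_mul]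

theorem linearizeHom_prod_X_mul_X_mul [DecidableEq σ] (I : Finset σ) (p : σ)
    (q : MvPolynomial σ ℝ) :
    linearizeHom Y ((∏ i ∈ I, X i) * X p * q) = linearizeHom Y ((∏ i ∈ insert p I, X i) * q) := by
  rw [prod_X_eq_monomial, prod_X_eq_monomial, X, monomial_mul, mul_one]
  refine linearizeHom_monomial_mul_congr Y ?_ q
  rw [support_sum_single]
  ext i
  simp [Finsupp.single_apply]
  grind

theorem linearizeHom_prod_X_mul_X [DecidableEq σ] (I : Finset σ) (p : σ) :
    linearizeHom Y ((∏ i ∈ I, X i) * X p) = Y (insert p I) := by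
  have := linearizeHom_prod_X_mul_X_mul Y I p 1
  rwa [mul_one, mul_one, linearizeHom_prod_X] at this

end Linearization

/-! ### The extended formulation as linear conditions on the variables `Y_I`. -/

section Points

open MvPolynomial

variable {V : Type*} [Fintype V] [DecidableEq V]

open Classical in
/-- The extended formulation of the `k`-th Sherali–Adams relaxation of the Tinhofer polytope in
terms of the variables `Y_I`. -/
structure IsTinhoferPoint (k : ℕ) (G H : SimpleGraph V) (Y : Finset (V × V) → ℝ) : Prop where
  one : Y ∅ = 1
  row : ∀ I : Finset (V × V), I.card + 1 ≤ k → ∀ u, ∑ w, Y (insert (u, w) I) = Y I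
  col : ∀ I : Finset (V × V), I.card + 1 ≤ k → ∀ v, ∑ w, Y (insert (w, v) I) = Y I
  adj : ∀ I : Finset (V × V), I.card + 1 ≤ k → ∀ u v,
    ∑ w with H.Adj v w, Y (insert (u, w) I) = ∑ w with G.Adj u w, Y (insert (w, v) I)
  nonneg : ∀ I : Finset (V × V), I.card ≤ k → 0 ≤ Y I

-- Splitting off one factor `1 - X p` gives a difference of two instances with smaller `K`; in the
-- second, `p` moves into `I`, so the degree bound is kept.
omit [Fintype V] in
theorem linearizeHom_mul_prod_one_sub {k : ℕ} {Y : Finset (V × V) → ℝ} (f : MvPolynomial (V × V) ℝ)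
    (hf : ∀ I : Finset (V × V), I.card + 1 ≤ k → linearizeHom Y ((∏ i ∈ I, X i) * f) = 0)
    (K : Finset (V × V)) : ∀ I : Finset (V × V), I.card + K.card + 1 ≤ k →
      linearizeHom Y ((∏ i ∈ I, X i) * (∏ i ∈ K, (1 - X i)) * f) = 0 := by
  induction K using Finset.induction_on with
  | empty => intro I hI; simpa using hf I (by simpa using hI)
  | insert p K hp ih =>
    intro I hI
    rw [Finset.card_insert_of_notMem hp] at hI
    have hc := Finset.card_insert_le p I
    have e : (∏ i ∈ I, X i) * (∏ i ∈ insert p K, (1 - X i)) * f =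
        (∏ i ∈ I, X i) * (∏ i ∈ K, (1 - X i)) * f -
          (∏ i ∈ I, X i) * X p * ((∏ i ∈ K, (1 - X i)) * f) := by
      rw [Finset.prod_insert hp]; ring
    rw [e, map_sub, linearizeHom_prod_X_mul_X_mul, ← mul_assoc, ih I (by omega),
      ih (insert p I) (by omega), sub_zero]

/-- Modulo the row equation, `1 - X p` is the sum of the other variables in the row of `p`. Thus
every mixed product reduces to a sum of pure products, and `0 ≤ Y I` suffices. -/
theorem linearizeHom_prod_one_sub_nonneg {k : ℕ} {Y : Finset (V × V) → ℝ}
    (hf : ∀ u : V, ∀ I : Finset (V × V), I.card + 1 ≤ k →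
      linearizeHom Y ((∏ i ∈ I, X i) * ((∑ w : V, X (u, w)) - 1)) = 0)
    (h0 : ∀ I : Finset (V × V), I.card ≤ k → 0 ≤ Y I)
    (K : Finset (V × V)) : ∀ I : Finset (V × V), I.card + K.card ≤ k →
      0 ≤ linearizeHom Y ((∏ i ∈ I, X i) * ∏ i ∈ K, (1 - X i)) := by
  induction K using Finset.induction_on with
  | empty => intro I hI; simpa [linearizeHom_prod_X] using h0 I (by simpa using hI)
  | insert p K hp ih =>
    intro I hI
    rw [Finset.card_insert_of_notMem hp] at hI
    have hz := linearizeHom_mul_prod_one_sub _ (hf p.1) K I (by omega)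
    have hs : (∑ w : V, X (p.1, w) : MvPolynomial (V × V) ℝ) =
        X p + ∑ w ∈ Finset.univ.erase p.2, X (p.1, w) :=
      (Finset.add_sum_erase _ (fun w => (X (p.1, w) : MvPolynomial (V × V) ℝ))
        (Finset.mem_univ p.2)).symm
    have e : (∏ i ∈ I, X i) * (∏ i ∈ insert p K, (1 - X i)) =
        (∑ w ∈ Finset.univ.erase p.2,
          (∏ i ∈ I, X i) * X (p.1, w) * (∏ i ∈ K, (1 - X i))) -
        (∏ i ∈ I, X i) * (∏ i ∈ K, (1 - X i)) *
          ((∑ w : V, X (p.1, w)) - 1 : MvPolynomial (V × V) ℝ) := by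
      rw [Finset.prod_insert hp, hs, ← Finset.sum_mul, ← Finset.mul_sum]; ring
    rw [e, map_sub, hz, sub_zero, map_sum]
    refine Finset.sum_nonneg fun w _ => ?_
    rw [linearizeHom_prod_X_mul_X_mul]
    exact ih _ (by have := Finset.card_insert_le (p.1, w) I; omega)

theorem mem_tinhoferExt_iff {k : ℕ} {G H : SimpleGraph V} {Y : Finset (V × V) → ℝ} :
    Y ∈ tinhoferExt k G H ↔ IsTinhoferPoint k G H Y := by
  classical
  have hrow : ∀ I : Finset (V × V), ∀ u : V,
      linearizeHom Y ((∏ i ∈ I, X i) * ((∑ w : V, X (u, w)) - 1)) =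
        ∑ w, Y (insert (u, w) I) - Y I := fun I u => by
    rw [mul_sub, mul_one, map_sub, Finset.mul_sum, map_sum, linearizeHom_prod_X]
    simp only [linearizeHom_prod_X_mul_X]
  have hcol : ∀ I : Finset (V × V), ∀ v : V,
      linearizeHom Y ((∏ i ∈ I, X i) * ((∑ w : V, X (w, v)) - 1)) =
        ∑ w, Y (insert (w, v) I) - Y I := fun I v => by
    rw [mul_sub, mul_one, map_sub, Finset.mul_sum, map_sum, linearizeHom_prod_X]
    simp only [linearizeHom_prod_X_mul_X]
  have hadj : ∀ I : Finset (V × V), ∀ u v : V,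
      linearizeHom Y ((∏ i ∈ I, X i) *
        ((∑ w : V with H.Adj v w, X (u, w)) - ∑ w : V with G.Adj u w, X (w, v))) =
        ∑ w with H.Adj v w, Y (insert (u, w) I) - ∑ w with G.Adj u w, Y (insert (w, v) I) :=
    fun I u v => by
      rw [mul_sub, map_sub, Finset.mul_sum, Finset.mul_sum, map_sum, map_sum]
      simp only [linearizeHom_prod_X_mul_X]
  constructor
  · rintro ⟨h1, heq, -, hpos⟩
    refine ⟨h1, fun I hI u => ?_, fun I hI v => ?_, fun I hI u v => ?_, fun I hI => ?_⟩
    · exact sub_eq_zero.1 ((hrow I u).symm.trans (heq _ (Or.inl (Or.inl ⟨u, rfl⟩)) I hI))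
    · exact sub_eq_zero.1 ((hcol I v).symm.trans (heq _ (Or.inl (Or.inr ⟨v, rfl⟩)) I hI))
    · exact sub_eq_zero.1 ((hadj I u v).symm.trans (heq _ (Or.inr ⟨u, v, rfl⟩) I hI))
    · have := hpos I I subset_rfl hI
      rw [Finset.sdiff_self, Finset.prod_empty, mul_one] at this
      exact this.trans_eq (linearizeHom_prod_X Y I)
  · intro h
    refine ⟨h.one, ?_, fun g hg => hg.elim, fun I J hIJ hJ => ?_⟩
    · rintro f ((⟨u, rfl⟩ | ⟨v, rfl⟩) | ⟨u, v, rfl⟩) I hI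
      · exact (hrow I u).trans (sub_eq_zero.2 (h.row I hI u))
      · exact (hcol I v).trans (sub_eq_zero.2 (h.col I hI v))
      · exact (hadj I u v).trans (sub_eq_zero.2 (h.adj I hI u v))
    · refine linearizeHom_prod_one_sub_nonneg
        (fun u I hI => (hrow I u).trans (sub_eq_zero.2 (h.row I hI u))) h.nonneg _ I ?_
      rw [Finset.card_sdiff_of_subset hIJ]
      have := Finset.card_le_card hIJ
      omega

end Points

/-! ### Degrees of tuples into colour classes. -/

section Counting

variable {V α : Type*} [Fintype V] [DecidableEq V] {k : ℕ}

open scoped Classical in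
/-- The number of tuples in the fibre of `f` over `c` that arise from `u` by replacing `u i` by a
neighbour. -/
noncomputable def nbrCount (G : SimpleGraph V) (f : (Fin k → V) → α) (c : α) (i : Fin k)
    (u : Fin k → V) : ℕ :=
  (Finset.univ.filter fun w => G.Adj (u i) w ∧ f (Function.update u i w) = c).card

open scoped Classical in
/-- The number of tuples in the fibre of `f` over `c` that arise from `u` by replacing `u i` by a
vertex that is not a neighbour. -/
noncomputable def nonNbrCount (G : SimpleGraph V) (f : (Fin k → V) → α) (c : α) (i : Fin k)
    (u : Fin k → V) : ℕ :=
  (Finset.univ.filter fun w => ¬ G.Adj (u i) w ∧ f (Function.update u i w) = c).card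

omit [DecidableEq V] in
theorem ncard_nbrTuples_inter (G : SimpleGraph V) (f : (Fin k → V) → α) (c : α) (i : Fin k)
    (u : Fin k → V) : (nbrTuples G i u ∩ {x | f x = c}).ncard = nbrCount G f c i u := by
  classical
  rw [nbrCount, ← Set.ncard_coe_finset,
    ← Set.ncard_image_of_injective _ (Function.update_injective u i)]
  congr 1
  ext x
  simp only [nbrTuples, Set.mem_inter_iff, Set.mem_ofPred_eq, Set.mem_image, Finset.coe_filter,
    Finset.mem_univ, true_and]
  constructor
  · rintro ⟨⟨w, hw, rfl⟩, hx⟩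
    exact ⟨w, ⟨hw, by convert hx⟩, by congr⟩
  · rintro ⟨w, ⟨hw, hc⟩, rfl⟩
    exact ⟨⟨w, hw, by congr⟩, by convert hc⟩

omit [DecidableEq V] in
theorem ncard_nonNbrTuples_inter (G : SimpleGraph V) (f : (Fin k → V) → α) (c : α) (i : Fin k)
    (u : Fin k → V) : (nonNbrTuples G i u ∩ {x | f x = c}).ncard = nonNbrCount G f c i u := by
  classical
  rw [nonNbrCount, ← Set.ncard_coe_finset,
    ← Set.ncard_image_of_injective _ (Function.update_injective u i)]
  congr 1
  ext x
  simp only [nonNbrTuples, Set.mem_inter_iff, Set.mem_ofPred_eq, Set.mem_image, Finset.coe_filter,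
    Finset.mem_univ, true_and]
  constructor
  · rintro ⟨⟨w, hw, rfl⟩, hx⟩
    exact ⟨w, ⟨hw, by convert hx⟩, by congr⟩
  · rintro ⟨w, ⟨hw, hc⟩, rfl⟩
    exact ⟨⟨w, hw, by congr⟩, by convert hc⟩

/-- `u` and `v` agree in their cells, in the cells of their images under `σ₁, σ₂`, in the ordered
subgraphs that they span, and in the degrees into each cell; cells are the fibres of `f` and `g`. -/
structure TupleMatch (σ₁ σ₂ : Equiv.Perm (Fin k)) (G H : SimpleGraph V) (f g : (Fin k → V) → α)
    (u v : Fin k → V) : Prop where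
  cell : f u = g v
  eq_iff : ∀ i j, u i = u j ↔ v i = v j
  adj_iff : ∀ i j, G.Adj (u i) (u j) ↔ H.Adj (v i) (v j)
  perm₁ : f (u ∘ σ₁) = g (v ∘ σ₁)
  perm₂ : f (u ∘ σ₂) = g (v ∘ σ₂)
  nbr : ∀ i c, nbrCount G f c i u = nbrCount H g c i v
  nonNbr : ∀ i c, nonNbrCount G f c i u = nonNbrCount H g c i v

end Counting

/-! ### Fractional isomorphisms preserve degrees into matched classes. -/

section FractionalIsomorphism

variable {V : Type*} [Fintype V]

-- In matrix form: `hst` and the row sums give `c s = M t`, hence `c A_G s = A_G M t = M A_H t`.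
open scoped Classical in
theorem fractionalIso_mul_degree {G H : SimpleGraph V} {M : V → V → ℝ} {c : ℝ}
    (hrow : ∀ u, ∑ w, M u w = c)
    (hadj : ∀ u v, ∑ w with H.Adj v w, M u w = ∑ w with G.Adj u w, M w v)
    {s t : V → ℝ} (hst : ∀ a b, M a b * s a = M a b * t b) (a : V) :
    c * ∑ x with G.Adj a x, s x = ∑ y, M a y * ∑ b with H.Adj y b, t b := by
  have h1 : c * ∑ x with G.Adj a x, s x = ∑ x with G.Adj a x, ∑ b, M x b * t b := by
    rw [Finset.mul_sum]
    refine Finset.sum_congr rfl fun x _ => ?_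
    rw [← hrow x, Finset.sum_mul]
    exact Finset.sum_congr rfl fun b _ => hst x b
  rw [h1, Finset.sum_comm]
  have h2 : ∀ b, ∑ x with G.Adj a x, M x b * t b = ∑ y, if H.Adj b y then M a y * t b else 0 := by
    intro b
    rw [← Finset.sum_mul, ← hadj, Finset.sum_mul, Finset.sum_filter]
  simp only [h2]
  rw [Finset.sum_comm]
  refine Finset.sum_congr rfl fun y _ => ?_
  rw [Finset.mul_sum, Finset.sum_filter]
  exact Finset.sum_congr rfl fun b _ => by simp only [H.adj_comm]

-- With `d = A_G s` and `e = A_H t` one has `c d = M e` and `c e = Mᵀ d`. So `dᵀ M e` equals both `c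
-- |d|²` and `c |e|²`, and `∑ M a b (d a - e b)² = 0` has only nonnegative terms.
open scoped Classical in
theorem fractionalIso_degree_eq {G H : SimpleGraph V} {M : V → V → ℝ} {c : ℝ}
    (h0 : ∀ u v, 0 ≤ M u v) (hrow : ∀ u, ∑ w, M u w = c) (hcol : ∀ v, ∑ w, M w v = c)
    (hadj : ∀ u v, ∑ w with H.Adj v w, M u w = ∑ w with G.Adj u w, M w v)
    {s t : V → ℝ} (hst : ∀ a b, M a b * s a = M a b * t b) {a b : V} (hab : M a b ≠ 0) :
    ∑ x with G.Adj a x, s x = ∑ y with H.Adj b y, t y := by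
  set d : V → ℝ := fun a => ∑ x with G.Adj a x, s x with hd
  set e : V → ℝ := fun b => ∑ y with H.Adj b y, t y with he
  have h1 : ∀ a, c * d a = ∑ y, M a y * e y := fractionalIso_mul_degree hrow hadj hst
  have h2 : ∀ b, c * e b = ∑ x, M x b * d x :=
    fractionalIso_mul_degree (M := fun a b => M b a) hcol (fun u v => (hadj v u).symm)
      (fun a b => (hst b a).symm)
  have hx : ∑ a, ∑ b, M a b * (d a * e b) = ∑ a, c * d a ^ 2 :=
    Finset.sum_congr rfl fun a _ => by
      rw [sq, ← mul_assoc, h1, Finset.sum_mul]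
      exact Finset.sum_congr rfl fun _ _ => by ring
  have hy : ∑ a, ∑ b, M a b * (d a * e b) = ∑ b, c * e b ^ 2 := by
    rw [Finset.sum_comm]
    refine Finset.sum_congr rfl fun a _ => ?_
    rw [sq, ← mul_assoc, h2, Finset.sum_mul]
    exact Finset.sum_congr rfl fun _ _ => by ring
  have hd2 : ∑ a, ∑ b, M a b * d a ^ 2 = ∑ a, c * d a ^ 2 :=
    Finset.sum_congr rfl fun a _ => by rw [← Finset.sum_mul, hrow]
  have he2 : ∑ a, ∑ b, M a b * e b ^ 2 = ∑ b, c * e b ^ 2 := by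
    rw [Finset.sum_comm]
    exact Finset.sum_congr rfl fun a _ => by rw [← Finset.sum_mul, hcol]
  have hz : ∑ a, ∑ b, M a b * (d a - e b) ^ 2 = 0 := by
    have : ∀ a b, M a b * (d a - e b) ^ 2 =
        M a b * d a ^ 2 + M a b * e b ^ 2 - 2 * (M a b * (d a * e b)) := fun a b => by ring
    simp only [this, Finset.sum_sub_distrib, Finset.sum_add_distrib, ← Finset.mul_sum]
    linarith
  have hn : ∀ a b, 0 ≤ M a b * (d a - e b) ^ 2 := fun a b => mul_nonneg (h0 a b) (sq_nonneg _)
  have hz' := (Finset.sum_eq_zero_iff_of_nonneg fun a _ => Finset.sum_nonneg fun b _ => hn a b).1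
    hz a (Finset.mem_univ a)
  have hz'' := (Finset.sum_eq_zero_iff_of_nonneg fun b _ => hn a b).1 hz' b (Finset.mem_univ b)
  exact sub_eq_zero.1 (pow_eq_zero_iff two_ne_zero |>.1 ((mul_eq_zero.1 hz'').resolve_left hab))

/-- A weighted bijection matches fibres of equal size. -/
theorem card_eq_of_doublyStochastic {A B : Type*} [Fintype A] [Fintype B] {M : A → B → ℝ} {c : ℝ}
    (hc : c ≠ 0) (hrow : ∀ u, ∑ w, M u w = c) (hcol : ∀ v, ∑ w, M w v = c)
    {p : A → Prop} {q : B → Prop} [DecidablePred p] [DecidablePred q]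
    (hpq : ∀ a b, M a b ≠ 0 → (p a ↔ q b)) :
    (Finset.univ.filter p).card = (Finset.univ.filter q).card := by
  have h : ∀ a b, (if p a then M a b else 0) = if q b then M a b else 0 := by
    intro a b
    by_cases hM : M a b = 0
    · simp [hM]
    · simp only [hpq a b hM]
  have h1 : ∑ a with p a, ∑ b, M a b = ∑ b with q b, ∑ a, M a b := by
    calc ∑ a with p a, ∑ b, M a b = ∑ a, ∑ b, if p a then M a b else 0 := by
          rw [Finset.sum_filter]
          exact Finset.sum_congr rfl fun a _ => by split_ifs <;> simp
      _ = ∑ b, ∑ a, if q b then M a b else 0 := by simp only [h]; exact Finset.sum_comm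
      _ = ∑ b with q b, ∑ a, M a b := by
          rw [Finset.sum_filter]
          exact Finset.sum_congr rfl fun b _ => by split_ifs <;> simp
  simp only [hrow, hcol, Finset.sum_const, nsmul_eq_mul] at h1
  exact_mod_cast mul_right_cancel₀ hc h1

-- The neighbour counts come from taking `s`, `t` to be indicators of `p`, `q`. The non-neighbour
-- counts follow by subtraction, since `p` and `q` hold equally often.
open scoped Classical in
theorem fractionalIso_card_eq {G H : SimpleGraph V} {M : V → V → ℝ} {c : ℝ}
    (h0 : ∀ u v, 0 ≤ M u v) (hrow : ∀ u, ∑ w, M u w = c) (hcol : ∀ v, ∑ w, M w v = c)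
    (hadj : ∀ u v, ∑ w with H.Adj v w, M u w = ∑ w with G.Adj u w, M w v)
    {p q : V → Prop} (hpq : ∀ a b, M a b ≠ 0 → (p a ↔ q b)) {a b : V} (hab : M a b ≠ 0) :
    (Finset.univ.filter fun w => G.Adj a w ∧ p w).card =
        (Finset.univ.filter fun w => H.Adj b w ∧ q w).card ∧
      (Finset.univ.filter fun w => ¬ G.Adj a w ∧ p w).card =
        (Finset.univ.filter fun w => ¬ H.Adj b w ∧ q w).card := by
  have h1 : (Finset.univ.filter fun w => G.Adj a w ∧ p w).card =
      (Finset.univ.filter fun w => H.Adj b w ∧ q w).card := by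
    have := fractionalIso_degree_eq h0 hrow hcol hadj (s := fun x => if p x then 1 else 0)
      (t := fun x => if q x then 1 else 0) (fun a b => by
        by_cases hM : M a b = 0
        · simp [hM]
        · simp only [hpq a b hM]) hab
    rw [← Finset.sum_filter, ← Finset.sum_filter, Finset.filter_filter, Finset.filter_filter,
      Finset.sum_const, Finset.sum_const, nsmul_one, nsmul_one] at this
    exact_mod_cast this
  have hc : c ≠ 0 := fun hc => hab
    ((Finset.sum_eq_zero_iff_of_nonneg fun b _ => h0 a b).1 ((hrow a).trans hc) b
      (Finset.mem_univ b))
  have h2 := card_eq_of_doublyStochastic hc hrow hcol hpq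
  have h3 := Finset.card_filter_add_card_filter_not (s := Finset.univ.filter p) (fun w => G.Adj a w)
  have h4 := Finset.card_filter_add_card_filter_not (s := Finset.univ.filter q) (fun w => H.Adj b w)
  simp only [Finset.filter_filter, and_comm (a := p _), and_comm (a := q _)] at h3 h4
  refine ⟨h1, by omega⟩

end FractionalIsomorphism

/-! ### Sets of pairs coming from two tuples. -/

section PairSet

variable {V : Type*} [DecidableEq V] {k : ℕ}

theorem pairSet_update (u v : Fin k → V) (i : Fin k) (a b : V) :
    pairSet (Function.update u i a) (Function.update v i b) =
      insert (a, b) ((Finset.univ.erase i).image fun j => (u j, v j)) := by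
  ext p
  simp only [pairSet, Finset.mem_image, Finset.mem_univ, true_and, Finset.mem_insert,
    Finset.mem_erase, and_true]
  constructor
  · rintro ⟨j, rfl⟩
    by_cases hj : j = i
    · subst hj; simp
    · exact Or.inr ⟨j, hj, by simp [hj]⟩
  · rintro (rfl | ⟨j, hj, rfl⟩)
    · exact ⟨i, by simp⟩
    · exact ⟨j, by simp [hj]⟩

theorem card_pairSet_le (u v : Fin k → V) : (pairSet u v).card ≤ k :=
  Finset.card_image_le.trans_eq (by simp)

theorem pairSet_comp_perm (u v : Fin k → V) (σ : Equiv.Perm (Fin k)) :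
    pairSet (u ∘ σ) (v ∘ σ) = pairSet u v := by
  ext p
  simp only [pairSet, Finset.mem_image, Finset.mem_univ, true_and, Function.comp_apply]
  exact σ.surjective.exists (p := fun i => (u i, v i) = p) |>.symm

theorem mem_pairSet (u v : Fin k → V) (i : Fin k) : (u i, v i) ∈ pairSet u v :=
  Finset.mem_image_of_mem _ (Finset.mem_univ i)

theorem pairSet_const (hk : 1 ≤ k) (a b : V) :
    pairSet (fun _ : Fin k => a) (fun _ => b) = {(a, b)} := by
  have : Nonempty (Fin k) := ⟨⟨0, hk⟩⟩
  exact Finset.image_const Finset.univ_nonempty _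

theorem card_image_erase_add_one_le (u v : Fin k → V) (i : Fin k) :
    ((Finset.univ.erase i).image fun j => (u j, v j)).card + 1 ≤ k := by
  have h := Finset.card_image_le (s := Finset.univ.erase i) (f := fun j => (u j, v j))
  rw [Finset.card_erase_of_mem (Finset.mem_univ i), Finset.card_univ, Fintype.card_fin] at h
  have := i.pos
  omega

theorem image_swap_pairSet (u v : Fin k → V) : (pairSet u v).image Prod.swap = pairSet v u := by
  simp only [pairSet, Finset.image_image]; rfl

end PairSet

/-! ### The support of a point respects the refinement step. -/

namespace IsTinhoferPoint

variable {V : Type*} [Fintype V] [DecidableEq V] {k : ℕ} {G H : SimpleGraph V}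
  {Y : Finset (V × V) → ℝ}

theorem symm (h : IsTinhoferPoint k G H Y) :
    IsTinhoferPoint k H G (fun I => Y (I.image Prod.swap)) where
  one := by simpa using h.one
  row I hI u := by
    simpa [Finset.image_insert] using h.col (I.image Prod.swap)
      (by rwa [Finset.card_image_of_injective _ Prod.swap_injective]) u
  col I hI u := by
    simpa [Finset.image_insert] using h.row (I.image Prod.swap)
      (by rwa [Finset.card_image_of_injective _ Prod.swap_injective]) u
  adj I hI u v := by
    simpa [Finset.image_insert] using (h.adj (I.image Prod.swap)
      (by rwa [Finset.card_image_of_injective _ Prod.swap_injective]) v u).symm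
  nonneg I hI := h.nonneg _ (by rwa [Finset.card_image_of_injective _ Prod.swap_injective])

theorem nonneg_insert (h : IsTinhoferPoint k G H Y) {I : Finset (V × V)} (hI : I.card + 1 ≤ k)
    (p : V × V) : 0 ≤ Y (insert p I) :=
  h.nonneg _ ((Finset.card_insert_le p I).trans hI)

theorem insert_le (h : IsTinhoferPoint k G H Y) {I : Finset (V × V)} (hI : I.card + 1 ≤ k)
    (p : V × V) : Y (insert p I) ≤ Y I := by
  rw [← h.row I hI p.1]
  exact Finset.single_le_sum (f := fun w => Y (insert (p.1, w) I))
    (fun w _ => h.nonneg_insert hI _) (Finset.mem_univ p.2)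

theorem union_le (h : IsTinhoferPoint k G H Y) (I K : Finset (V × V)) :
    (I ∪ K).card ≤ k → Y (I ∪ K) ≤ Y I := by
  induction K using Finset.induction_on with
  | empty => simp
  | insert p K _ ih =>
    intro hc
    rw [Finset.union_insert] at hc ⊢
    by_cases hp : p ∈ I ∪ K
    · rw [Finset.insert_eq_of_mem hp] at hc ⊢
      exact ih hc
    · rw [Finset.card_insert_of_notMem hp] at hc
      exact (h.insert_le hc p).trans (ih (by omega))

theorem ne_zero_of_subset (h : IsTinhoferPoint k G H Y) {I J : Finset (V × V)} (hIJ : I ⊆ J)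
    (hJ : J.card ≤ k) (h0 : Y J ≠ 0) : Y I ≠ 0 := by
  have h1 := h.union_le I J (by rwa [Finset.union_eq_right.2 hIJ])
  rw [Finset.union_eq_right.2 hIJ] at h1
  exact (((h.nonneg J hJ).lt_of_ne' h0).trans_le h1).ne'

/-- In the row equation of `a` over `I = J \ {(a, b')}`, the term at `b` is already all of `Y I`,
because `(a, b) ∈ I`. The nonnegative remaining terms, among them `Y J`, must vanish. -/
theorem snd_eq (h : IsTinhoferPoint k G H Y) {J : Finset (V × V)} (hJ : J.card ≤ k) (h0 : Y J ≠ 0)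
    {a b b' : V} (hb : (a, b) ∈ J) (hb' : (a, b') ∈ J) : b = b' := by
  by_contra hne
  have hI : (J.erase (a, b')).card + 1 ≤ k := by rwa [Finset.card_erase_add_one hb']
  have hmem : (a, b) ∈ J.erase (a, b') := Finset.mem_erase.2 ⟨by simp [hne], hb⟩
  have hr := h.row _ hI a
  rw [← Finset.add_sum_erase _ _ (Finset.mem_univ b), Finset.insert_eq_of_mem hmem] at hr
  have hs := Finset.single_le_sum (f := fun w => Y (insert (a, w) (J.erase (a, b'))))
    (fun w _ => h.nonneg_insert hI _)
    (Finset.mem_erase.2 ⟨Ne.symm hne, Finset.mem_univ b'⟩ : b' ∈ Finset.univ.erase b)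
  simp only [Finset.insert_erase hb'] at hs
  have := (h.nonneg J hJ).lt_of_ne' h0
  linarith

theorem fst_eq (h : IsTinhoferPoint k G H Y) {J : Finset (V × V)} (hJ : J.card ≤ k) (h0 : Y J ≠ 0)
    {a a' b : V} (hb : (a, b) ∈ J) (hb' : (a', b) ∈ J) : a = a' := by
  refine h.symm.snd_eq (J := J.image Prod.swap)
    (by rwa [Finset.card_image_of_injective _ Prod.swap_injective]) ?_
    (Finset.mem_image_of_mem Prod.swap hb) (Finset.mem_image_of_mem Prod.swap hb')
  simpa [Finset.image_image] using h0

theorem adj_of_adj (h : IsTinhoferPoint k G H Y) {J : Finset (V × V)} (hJ : J.card ≤ k)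
    (h0 : Y J ≠ 0) {a a' b b' : V} (hb : (a, b) ∈ J) (hb' : (a', b') ∈ J) (hG : G.Adj a a') :
    H.Adj b b' := by
  classical
  by_contra hH
  have hI : (J.erase (a', b')).card + 1 ≤ k := by rwa [Finset.card_erase_add_one hb']
  have hmem : (a, b) ∈ J.erase (a', b') := by
    refine Finset.mem_erase.2 ⟨fun he => ?_, hb⟩
    exact hG.ne (Prod.ext_iff.1 he).1
  have hr := h.row _ hI a'
  -- Let `I` be the erased set. The neighbour part of this row equals, by the adjacency equation, a
  -- sum containing the term `w = a`, which is `Y I` itself. Nothing is left for the non-neighbour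
  -- part, where `Y J` occurs.
  rw [← Finset.sum_filter_add_sum_filter_not _ (fun w => H.Adj b w)] at hr
  have ha := h.adj _ hI a' b
  have h1 := Finset.single_le_sum (f := fun w => Y (insert (w, b) (J.erase (a', b'))))
    (fun w _ => h.nonneg_insert hI _)
    (Finset.mem_filter.2 ⟨Finset.mem_univ a, hG.symm⟩ : a ∈ Finset.univ.filter (G.Adj a'))
  have h2 := Finset.single_le_sum (f := fun w => Y (insert (a', w) (J.erase (a', b'))))
    (fun w _ => h.nonneg_insert hI _)
    (Finset.mem_filter.2 ⟨Finset.mem_univ b', hH⟩ : b' ∈ Finset.univ.filter (¬ H.Adj b ·))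
  simp only [Finset.insert_erase hb', Finset.insert_eq_of_mem hmem] at h1 h2
  have := (h.nonneg J hJ).lt_of_ne' h0
  have e : ∑ w with H.Adj b w, Y (insert (a', w) (J.erase (a', b'))) =
    ∑ w with G.Adj a' w, Y (insert (w, b) (J.erase (a', b'))) := by convert ha
  linarith

theorem adj_iff_adj (h : IsTinhoferPoint k G H Y) {J : Finset (V × V)} (hJ : J.card ≤ k)
    (h0 : Y J ≠ 0) {a a' b b' : V} (hb : (a, b) ∈ J) (hb' : (a', b') ∈ J) :
    G.Adj a a' ↔ H.Adj b b' := by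
  refine ⟨h.adj_of_adj hJ h0 hb hb', h.symm.adj_of_adj (J := J.image Prod.swap)
    (by rwa [Finset.card_image_of_injective _ Prod.swap_injective]) ?_
    (Finset.mem_image_of_mem Prod.swap hb) (Finset.mem_image_of_mem Prod.swap hb')⟩
  simpa [Finset.image_image] using h0

/-- Varying the `i`-th entries leaves a fixed set of at most `k - 1` pairs, so the defining
equations over that set make the matrix of values a fractional isomorphism with row sum `c`. -/
theorem tupleMatch (h : IsTinhoferPoint k G H Y) {α : Type*} {f g : (Fin k → V) → α}
    (hfg : ∀ u v, f u ≠ g v → Y (pairSet u v) = 0) (σ₁ σ₂ : Equiv.Perm (Fin k))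
    {u v : Fin k → V} (h0 : Y (pairSet u v) ≠ 0) : TupleMatch σ₁ σ₂ G H f g u v := by
  have hcell : ∀ u v, Y (pairSet u v) ≠ 0 → f u = g v :=
    fun u v h => by_contra fun h' => h (hfg u v h')
  have hcount : ∀ i c, nbrCount G f c i u = nbrCount H g c i v ∧
      nonNbrCount G f c i u = nonNbrCount H g c i v := by
    intro i c
    have hI := card_image_erase_add_one_le u v i
    refine fractionalIso_card_eq
      (M := fun a b => Y (pairSet (Function.update u i a) (Function.update v i b)))
      (c := Y ((Finset.univ.erase i).image fun j => (u j, v j))) (fun a b => ?_) (fun a => ?_)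
      (fun b => ?_) (fun a b => ?_) (fun a b hab => ?_) ?_
    · exact h.nonneg _ (card_pairSet_le _ _)
    · simp only [pairSet_update]; exact h.row _ hI a
    · simp only [pairSet_update]; exact h.col _ hI b
    · simp only [pairSet_update]; exact h.adj _ hI a b
    · rw [hcell _ _ hab]
    · simpa using h0
  exact
  { cell := hcell u v h0
    eq_iff := fun i j => ⟨fun e => h.snd_eq (card_pairSet_le u v) h0 (mem_pairSet u v i)
        (e ▸ mem_pairSet u v j), fun e => h.fst_eq (card_pairSet_le u v) h0 (mem_pairSet u v i)
        (e ▸ mem_pairSet u v j)⟩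
    adj_iff := fun i j => h.adj_iff_adj (card_pairSet_le u v) h0 (mem_pairSet u v i)
      (mem_pairSet u v j)
    perm₁ := hcell _ _ (by rwa [pairSet_comp_perm])
    perm₂ := hcell _ _ (by rwa [pairSet_comp_perm])
    nbr := fun i c => (hcount i c).1
    nonNbr := fun i c => (hcount i c).2 }

/-- The row equation is applied one coordinate at a time. For `m = k`, `I = ∅` it shows that `Y` is
doubly stochastic on `k`-tuples, so every tuple has a partner. -/
theorem sum_union_tuple (h : IsTinhoferPoint k G H Y) (m : ℕ) :
    ∀ I : Finset (V × V), I.card + m ≤ k → ∀ u : Fin m → V,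
      ∑ v : Fin m → V, Y (pairSet u v ∪ I) = Y I := by
  induction m with
  | zero => intro I _ u; simp [pairSet]
  | succ m ih =>
    intro I hI u
    have e : ∀ (a : V) (v : Fin m → V), pairSet u (Fin.cons a v : Fin (m + 1) → V) ∪ I =
        pairSet (Fin.tail u) v ∪ insert (u 0, a) I := by
      intro a v
      ext p
      simp only [pairSet, Finset.mem_union, Finset.mem_image, Finset.mem_univ, true_and,
        Fin.exists_fin_succ, Fin.cons_zero, Fin.cons_succ, Finset.mem_insert, Fin.tail]
      grind
    rw [← (Fin.consEquiv fun _ : Fin (m + 1) => V).sum_comp, Fintype.sum_prod_type]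
    have hi : ∀ a, (insert (u 0, a) I).card + m ≤ k := fun a => by
      have := Finset.card_insert_le (u 0, a) I; omega
    calc _ = ∑ a, ∑ v : Fin m → V, Y (pairSet (Fin.tail u) v ∪ insert (u 0, a) I) :=
          Finset.sum_congr rfl fun a _ => Finset.sum_congr rfl fun v _ => by rw [← e]; rfl
      _ = ∑ a, Y (insert (u 0, a) I) := Finset.sum_congr rfl fun a _ => ih _ (hi a) _
      _ = Y I := h.row I (by omega) _

theorem sum_pairSet (h : IsTinhoferPoint k G H Y) (u : Fin k → V) :
    ∑ v : Fin k → V, Y (pairSet u v) = 1 := by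
  simpa [h.one] using h.sum_union_tuple k ∅ (by simp) u

theorem sum_pairSet' (h : IsTinhoferPoint k G H Y) (v : Fin k → V) :
    ∑ u : Fin k → V, Y (pairSet u v) = 1 := by
  simpa [image_swap_pairSet] using h.symm.sum_pairSet v

theorem exists_right (h : IsTinhoferPoint k G H Y) (u : Fin k → V) :
    ∃ v : Fin k → V, Y (pairSet u v) ≠ 0 := by
  by_contra! h0
  simpa [h0] using h.sum_pairSet u

theorem exists_left (h : IsTinhoferPoint k G H Y) (v : Fin k → V) :
    ∃ u : Fin k → V, Y (pairSet u v) ≠ 0 := by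
  by_contra! h0
  simpa [h0] using h.sum_pairSet' v

end IsTinhoferPoint

/-- Every self-map of a finite type is the composition of an idempotent with a permutation. -/
theorem exists_perm_comp_idempotent {ι : Type*} [Fintype ι] (t : ι → ι) :
    ∃ (σ : Equiv.Perm ι) (e : ι → ι), e ∘ e = e ∧ t = σ ∘ e := by
  classical
  rcases isEmpty_or_nonempty ι with hι | hι
  · exact ⟨1, id, rfl, funext fun i => isEmptyElim i⟩
  have ht : ∀ i, t (Function.invFun t (t i)) = t i := fun i => Function.invFun_eq ⟨i, rfl⟩
  -- The idempotent sends `i` to a chosen representative of its `t`-fibre; `t` is injective on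
  -- representatives and extends from them to a permutation.
  obtain ⟨σ, hσ⟩ := Finset.exists_equiv_extend_of_card_eq (α := ι) (t := (Finset.univ : Finset ι))
    (Finset.card_univ (α := ι)).symm (s := Finset.univ.image fun i => Function.invFun t (t i))
    (f := t) (Finset.subset_univ _) (by
      intro a ha b hb hab
      simp only [Finset.coe_image, Finset.coe_univ, Set.image_univ, Set.mem_range] at ha hb
      obtain ⟨i, rfl⟩ := ha
      obtain ⟨j, rfl⟩ := hb
      rw [ht, ht] at hab
      simp only [hab])
  refine ⟨σ.trans (Equiv.subtypeUnivEquiv Finset.mem_univ), fun i => Function.invFun t (t i),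
    funext fun i => by simp only [Function.comp_apply, ht], funext fun i => ?_⟩
  exact ((hσ _ (Finset.mem_image_of_mem _ (Finset.mem_univ i))).trans (ht i)).symm

/-! ### Linked colourings: invariance under reindexing, and class weights. -/

section Linked

variable {V α : Type*} [Fintype V] {k : ℕ}

open scoped Classical in
/-- The size of the fibre of `f` over `c`. -/
noncomputable def fibreCard (f : (Fin k → V) → α) (c : α) : ℕ :=
  (Finset.univ.filter fun u => f u = c).card

/-- Stable colourings `f`, `g` of the tuples with equal colour class sizes. -/
structure Linked (σ₁ σ₂ : Equiv.Perm (Fin k)) (G H : SimpleGraph V) (f g : (Fin k → V) → α) :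
    Prop where
  tupleMatch : ∀ u v, f u = g v → TupleMatch σ₁ σ₂ G H f g u v
  fibreCard_eq : ∀ c, fibreCard f c = fibreCard g c

theorem fibreCard_pos_iff (f : (Fin k → V) → α) (c : α) : 0 < fibreCard f c ↔ ∃ u, f u = c := by
  simp [fibreCard, Finset.card_pos, Finset.Nonempty]

namespace Linked

variable {σ₁ σ₂ : Equiv.Perm (Fin k)} {G H : SimpleGraph V} {f g : (Fin k → V) → α}

theorem symm (h : Linked σ₁ σ₂ G H f g) : Linked σ₁ σ₂ H G g f where
  tupleMatch u v huv :=
    have m := h.tupleMatch v u huv.symm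
    ⟨huv, fun i j => (m.eq_iff i j).symm, fun i j => (m.adj_iff i j).symm, m.perm₁.symm,
      m.perm₂.symm, fun i c => (m.nbr i c).symm, fun i c => (m.nonNbr i c).symm⟩
  fibreCard_eq c := (h.fibreCard_eq c).symm

theorem exists_left (h : Linked σ₁ σ₂ G H f g) (v : Fin k → V) : ∃ u, f u = g v := by
  rw [← fibreCard_pos_iff, h.fibreCard_eq, fibreCard_pos_iff]; exact ⟨v, rfl⟩

/-- Two tuples on the same side in the same class match. -/
theorem tupleMatch_right (h : Linked σ₁ σ₂ G H f g) {v w : Fin k → V} (hvw : g v = g w) :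
    TupleMatch σ₁ σ₂ H H g g v w := by
  obtain ⟨u, hu⟩ := h.exists_left v
  have m := h.tupleMatch u v hu
  have n := h.tupleMatch u w (hu.trans hvw)
  exact ⟨hvw, fun i j => (m.eq_iff i j).symm.trans (n.eq_iff i j),
    fun i j => (m.adj_iff i j).symm.trans (n.adj_iff i j), m.perm₁.symm.trans n.perm₁,
    m.perm₂.symm.trans n.perm₂, fun i c => (m.nbr i c).symm.trans (n.nbr i c),
    fun i c => (m.nonNbr i c).symm.trans (n.nonNbr i c)⟩

theorem comp_perm (h : Linked σ₁ σ₂ G H f g) (hσ : Subgroup.closure {σ₁, σ₂} = ⊤)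
    (σ : Equiv.Perm (Fin k)) : ∀ u v, f u = g v → f (u ∘ σ) = g (v ∘ σ) := by
  have hmem : σ ∈ Subgroup.closure {σ₁, σ₂} := hσ ▸ Subgroup.mem_top σ
  induction hmem using Subgroup.closure_induction with
  | mem x hx =>
    intro u v huv
    rcases hx with rfl | rfl
    · exact (h.tupleMatch u v huv).perm₁
    · exact (h.tupleMatch u v huv).perm₂
  | one => exact fun u v huv => huv
  | mul x y _ _ hx hy => exact fun u v huv => hy _ _ (hx u v huv)
  | inv x _ hx =>
    -- The induction hypothesis is a one-way implication and cannot be inverted directly; in a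
    -- finite group `x⁻¹` is a nonnegative power of `x`.
    have hpow : ∀ n : ℕ, ∀ u v, f u = g v → f (u ∘ ⇑(x ^ n)) = g (v ∘ ⇑(x ^ n)) := by
      intro n
      induction n with
      | zero => exact fun u v huv => huv
      | succ n ih => exact fun u v huv => by rw [pow_succ]; exact hx _ _ (ih u v huv)
    obtain ⟨n, hn⟩ := (isOfFinOrder_of_finite x).mem_powers_iff_mem_zpowers.2
      (Subgroup.mem_zpowers_iff.2 ⟨-1, zpow_neg_one x⟩ : x⁻¹ ∈ Subgroup.zpowers x)
    simp only at hn
    exact hn ▸ hpow n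

/-- Matching tuples still match after copying entry `j` to entry `i`. -/
theorem update_eq (h : Linked σ₁ σ₂ G H f g) {u v : Fin k → V} (huv : f u = g v) (i j : Fin k) :
    f (Function.update u i (u j)) = g (Function.update v i (v j)) := by
  classical
  by_cases hij : i = j
  · subst hij; simpa using huv
  have m := h.tupleMatch u v huv
  -- The copied tuple has equal entries at `i` and `j`, so a partner of the form `v[i := w]` must
  -- have `w = v j`. Equal degrees into its class supply such a `w`.
  have key : ∀ w, f (Function.update u i (u j)) = g (Function.update v i w) → w = v j := by
    intro w hw
    have := ((h.tupleMatch _ _ hw).eq_iff i j).1 (by simp [Ne.symm hij])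
    simpa [Ne.symm hij] using this
  by_cases hadj : G.Adj (u i) (u j)
  · have hpos : 0 < nbrCount G f (f (Function.update u i (u j))) i u :=
      Finset.card_pos.2 ⟨u j, by simp [hadj]⟩
    rw [m.nbr, nbrCount, Finset.card_pos] at hpos
    obtain ⟨w, hw⟩ := hpos
    have hw' := (Finset.mem_filter.1 hw).2.2
    rw [← key w hw'.symm, hw']
  · have hpos : 0 < nonNbrCount G f (f (Function.update u i (u j))) i u :=
      Finset.card_pos.2 ⟨u j, by simp [hadj]⟩
    rw [m.nonNbr, nonNbrCount, Finset.card_pos] at hpos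
    obtain ⟨w, hw⟩ := hpos
    have hw' := (Finset.mem_filter.1 hw).2.2
    rw [← key w hw'.symm, hw']

theorem comp_idempotent (h : Linked σ₁ σ₂ G H f g) {e : Fin k → Fin k} (he : e ∘ e = e)
    {u v : Fin k → V} (huv : f u = g v) : f (u ∘ e) = g (v ∘ e) := by
  have key : ∀ S : Finset (Fin k),
      f (fun i => if i ∈ S then u (e i) else u i) = g (fun i => if i ∈ S then v (e i) else v i) := by
    intro S
    induction S using Finset.induction_on with
    | empty => simpa using huv
    | insert i S hi ih =>
      -- Idempotence keeps entry `e i` equal to `u (e i)` throughout, so each step is the copying of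
      -- one current entry to another.
      have hu : ∀ u : Fin k → V, (fun x => if x ∈ insert i S then u (e x) else u x) =
          Function.update (fun x => if x ∈ S then u (e x) else u x) i
            ((fun x => if x ∈ S then u (e x) else u x) (e i)) := by
        intro u
        funext x
        have hx : e (e i) = e i := congrFun he i
        by_cases hxi : x = i
        · subst hxi; simp [hx]
        · simp [hxi]
      rw [hu, hu]
      exact h.update_eq ih i (e i)
  simpa [Function.comp_def] using key Finset.univ

theorem comp (h : Linked σ₁ σ₂ G H f g) (hσ : Subgroup.closure {σ₁, σ₂} = ⊤)
    {u v : Fin k → V} (huv : f u = g v) (t : Fin k → Fin k) : f (u ∘ t) = g (v ∘ t) := by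
  obtain ⟨σ, e, he, rfl⟩ := exists_perm_comp_idempotent t
  exact h.comp_idempotent he (h.comp_perm hσ σ u v huv)

theorem comp_right (h : Linked σ₁ σ₂ G H f g) (hσ : Subgroup.closure {σ₁, σ₂} = ⊤)
    {v w : Fin k → V} (hvw : g v = g w) (t : Fin k → Fin k) : g (v ∘ t) = g (w ∘ t) := by
  obtain ⟨u, hu⟩ := h.exists_left v
  exact (h.comp hσ hu t).symm.trans (h.comp hσ (hu.trans hvw) t)

/-- Composition with `t` injects the class of `v` into that of `w`: members of the class of `v`
share its equality pattern, so `x` is recovered as `(x ∘ t) ∘ s`. -/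
theorem fibreCard_comp_le (h : Linked σ₁ σ₂ G H f g) (hσ : Subgroup.closure {σ₁, σ₂} = ⊤)
    {v w : Fin k → V} {s t : Fin k → Fin k} (hv : v = w ∘ s) (hw : w = v ∘ t) :
    fibreCard g (g v) ≤ fibreCard g (g w) := by
  classical
  refine Finset.card_le_card_of_injOn (fun x => x ∘ t) (fun x hx => ?_) (fun x hx y hy hxy => ?_)
  · simp only [Finset.coe_filter, Finset.mem_univ, true_and, Set.mem_ofPred_eq] at hx ⊢
    rw [h.comp_right hσ hx t, ← hw]
  · simp only [Finset.coe_filter, Finset.mem_univ, true_and, Set.mem_ofPred_eq] at hx hy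
    have hts : ∀ i, v (t (s i)) = v i := fun i => by
      have h1 := congrFun hw (s i)
      have h2 := congrFun hv i
      simp only [Function.comp_apply] at h1 h2
      rw [← h1, h2]
    funext i
    rw [← ((h.tupleMatch_right hx).eq_iff _ _).2 (hts i),
      ← ((h.tupleMatch_right hy).eq_iff _ _).2 (hts i)]
    exact congrFun hxy (s i)

end Linked

omit [Fintype V] in
theorem exists_comp_of_pairSet_subset [DecidableEq V] {u v u' v' : Fin k → V}
    (h : pairSet u' v' ⊆ pairSet u v) :
    ∃ t : Fin k → Fin k, u' = u ∘ t ∧ v' = v ∘ t := by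
  have : ∀ i, ∃ j, u j = u' i ∧ v j = v' i := fun i => by
    simpa [pairSet] using h (mem_pairSet u' v' i)
  choose t ht using this
  exact ⟨t, funext fun i => (ht i).1.symm, funext fun i => (ht i).2.symm⟩

open scoped Classical in
/-- The value at `⟨u, v⟩` of the point that belongs to the colourings `f` and `g`. -/
noncomputable def classWeight (f g : (Fin k → V) → α) (u v : Fin k → V) : ℝ :=
  if f u = g v then (fibreCard f (f u) : ℝ)⁻¹ else 0

open scoped Classical in
/-- The point that belongs to the colourings `f` and `g`. -/
noncomputable def classPoint [DecidableEq V] (f g : (Fin k → V) → α) (I : Finset (V × V)) : ℝ :=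
  if I = ∅ then 1
  else if h : ∃ p : (Fin k → V) × (Fin k → V), pairSet p.1 p.2 = I then
    classWeight f g h.choose.1 h.choose.2
  else 0

namespace Linked

variable {σ₁ σ₂ : Equiv.Perm (Fin k)} {G H : SimpleGraph V} {f g : (Fin k → V) → α}

theorem classWeight_comm (h : Linked σ₁ σ₂ G H f g) (u v : Fin k → V) :
    classWeight f g u v = classWeight g f v u := by
  unfold classWeight
  by_cases huv : f u = g v
  · rw [if_pos huv, if_pos huv.symm, h.fibreCard_eq, huv]
  · rw [if_neg huv, if_neg (Ne.symm huv)]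

/-- Pairs of tuples with the same pair set are reindexings of each other in both directions, so
matching transfers and the class sizes coincide. -/
theorem classWeight_congr [DecidableEq V] (h : Linked σ₁ σ₂ G H f g) (hσ : Subgroup.closure {σ₁, σ₂} = ⊤)
    {u v u' v' : Fin k → V} (hp : pairSet u v = pairSet u' v') :
    classWeight f g u v = classWeight f g u' v' := by
  obtain ⟨t, hu', hv'⟩ := exists_comp_of_pairSet_subset hp.ge
  obtain ⟨s, hu, hv⟩ := exists_comp_of_pairSet_subset hp.le
  unfold classWeight
  by_cases huv : f u = g v
  · have huv' : f u' = g v' := by rw [hu', hv']; exact h.comp hσ huv t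
    rw [if_pos huv, if_pos huv', le_antisymm (h.symm.fibreCard_comp_le hσ hu hu')
      (h.symm.fibreCard_comp_le hσ hu' hu)]
  · have huv' : f u' ≠ g v' := fun h' => huv (by rw [hu, hv]; exact h.comp hσ h' s)
    rw [if_neg huv, if_neg huv']

theorem classPoint_pairSet [DecidableEq V] (h : Linked σ₁ σ₂ G H f g) (hk : 1 ≤ k)
    (hσ : Subgroup.closure {σ₁, σ₂} = ⊤) (u v : Fin k → V) :
    classPoint f g (pairSet u v) = classWeight f g u v := by
  have hne : pairSet u v ≠ ∅ := Finset.ne_empty_of_mem (mem_pairSet u v ⟨0, hk⟩)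
  have hex : ∃ p : (Fin k → V) × (Fin k → V), pairSet p.1 p.2 = pairSet u v := ⟨(u, v), rfl⟩
  rw [classPoint, if_neg hne, dif_pos hex]
  exact h.classWeight_congr hσ hex.choose_spec

end Linked

end Linked

/-! ### The class weights satisfy the equations of the relaxation. -/

section ClassPoint

variable {V α : Type*} [Fintype V] {k : ℕ}

open scoped Classical in
theorem card_update_eq (H : SimpleGraph V) (g : (Fin k → V) → α) (c : α) (i : Fin k)
    (x : Fin k → V) :
    (Finset.univ.filter fun w => g (Function.update x i w) = c).card =
      nbrCount H g c i x + nonNbrCount H g c i x := by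
  have := Finset.card_filter_add_card_filter_not
    (s := Finset.univ.filter fun w => g (Function.update x i w) = c) (fun w => H.Adj (x i) w)
  simp only [Finset.filter_filter, and_comm (a := g _ = c)] at this
  exact this.symm

namespace Linked

variable {σ₁ σ₂ : Equiv.Perm (Fin k)} {G H : SimpleGraph V} {f g : (Fin k → V) → α}

-- Copying entry `j` to entry `i` maps the class of `v[i := b]` into the class of `v`. Over each `x`
-- there the fibre consists of the `x[i := w]` in the former class, and stability makes their number
-- independent of `x`.
open scoped Classical in
theorem fibreCard_eq_mul (h : Linked σ₁ σ₂ G H f g) {v : Fin k → V} {i j : Fin k} (hij : i ≠ j)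
    (hv : v i = v j) (b : V) :
    fibreCard g (g (Function.update v i b)) =
      fibreCard g (g v) *
        (Finset.univ.filter fun w => g (Function.update v i w) = g (Function.update v i b)).card := by
  set c := g (Function.update v i b) with hc
  have hcopy : ∀ y, g y = c → g (Function.update y i (y j)) = g v := by
    intro y hy
    obtain ⟨u, hu⟩ := h.exists_left y
    have h1 := h.update_eq hu i j
    have h2 := h.update_eq (hu.trans (hy.trans hc)) i j
    rw [← h1, h2]
    simp [hij.symm, ← hv]
  have hmaps : ((Finset.univ.filter fun y => g y = c : Finset (Fin k → V)) : Set (Fin k → V)).MapsTo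
      (fun y => Function.update y i (y j)) (Finset.univ.filter fun x => g x = g v) := by
    intro y hy
    simp only [Finset.coe_filter, Finset.mem_univ, true_and, Set.mem_ofPred_eq] at hy ⊢
    exact hcopy y hy
  rw [fibreCard, Finset.card_eq_sum_card_fiberwise hmaps, fibreCard]
  refine Finset.sum_const_nat fun x hx => ?_
  have hxv : g v = g x := (Finset.mem_filter.1 hx).2.symm
  have m := h.tupleMatch_right hxv
  have hxij : x i = x j := (m.eq_iff i j).1 hv
  rw [card_update_eq H, m.nbr, m.nonNbr, ← card_update_eq H, Finset.filter_filter,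
    ← Finset.card_image_of_injective _ (Function.update_injective x i)]
  congr 1
  ext y
  simp only [Finset.mem_filter, Finset.mem_univ, true_and, Finset.mem_image]
  constructor
  · rintro ⟨hy, rfl⟩
    exact ⟨y i, by simpa using hy, by simp⟩
  · rintro ⟨w, hw, rfl⟩
    refine ⟨hw, ?_⟩
    simp [hij.symm, ← hxij]

/-- If `u` and `v` match, the `n` nonzero terms are each `1 / (N n)`, where `N` is the class size of
`u`. If not, any nonzero term would yield a match by copying entry `j` back to `i`. -/
theorem sum_classWeight_row (h : Linked σ₁ σ₂ G H f g) {u v : Fin k → V} {i j : Fin k}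
    (hij : i ≠ j) (hu : u i = u j) (hv : v i = v j) (a : V) :
    ∑ w, classWeight f g (Function.update u i a) (Function.update v i w) =
      classWeight f g u v := by
  classical
  have hback : ∀ w, f (Function.update u i a) = g (Function.update v i w) → f u = g v := by
    intro w hw
    simpa [hij.symm, ← hu, ← hv] using h.update_eq hw i j
  by_cases huv : f u = g v
  · have hN : fibreCard f (f u) ≠ 0 := ((fibreCard_pos_iff f _).2 ⟨u, rfl⟩).ne'
    have hN' : fibreCard f (f (Function.update u i a)) ≠ 0 :=
      ((fibreCard_pos_iff f _).2 ⟨_, rfl⟩).ne'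
    have hmul := h.symm.fibreCard_eq_mul hij hu a
    have m := h.tupleMatch u v huv
    rw [card_update_eq G, m.nbr, m.nonNbr, ← card_update_eq H] at hmul
    simp only [classWeight]
    rw [if_pos huv, ← Finset.sum_filter, Finset.sum_const, nsmul_eq_mul]
    simp only [eq_comm (a := f (Function.update u i a))]
    rw [hmul] at hN' ⊢
    have hn := right_ne_zero_of_mul hN'
    push_cast
    have hN1 : (fibreCard f (f u) : ℝ) ≠ 0 := by exact_mod_cast hN
    have hn1 : ((Finset.univ.filter fun w =>
      g (Function.update v i w) = f (Function.update u i a)).card : ℝ) ≠ 0 := by exact_mod_cast hn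
    field_simp
  · simp only [classWeight]
    rw [if_neg huv]
    exact Finset.sum_eq_zero fun w _ => if_neg fun hw => huv (hback w hw)

theorem sum_classWeight_col (h : Linked σ₁ σ₂ G H f g) {u v : Fin k → V} {i j : Fin k}
    (hij : i ≠ j) (hu : u i = u j) (hv : v i = v j) (b : V) :
    ∑ w, classWeight f g (Function.update u i w) (Function.update v i b) =
      classWeight f g u v := by
  simp only [h.classWeight_comm]
  exact h.symm.sum_classWeight_row hij hv hu b

/-- This is the row equation over `I = ∅`. Tuples matching a constant tuple are constant, so the
number of nonzero terms is the class size. -/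
theorem sum_classWeight_const_row (h : Linked σ₁ σ₂ G H f g) (hk : 1 ≤ k) (a : V) :
    ∑ w, classWeight f g (fun _ => a) (fun _ => w) = 1 := by
  classical
  have : Nonempty (Fin k) := ⟨⟨0, hk⟩⟩
  have hN : (fibreCard f (f fun _ => a) : ℝ) ≠ 0 := by
    exact_mod_cast ((fibreCard_pos_iff f _).2 ⟨_, rfl⟩).ne'
  have hcard : fibreCard f (f fun _ => a) =
      (Finset.univ.filter fun w => f (fun _ => a) = g (fun _ => w)).card := by
    rw [h.fibreCard_eq, fibreCard,
      ← Finset.card_image_of_injective _ (Function.const_injective (α := Fin k) (β := V))]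
    congr 1
    ext y
    simp only [Finset.mem_filter, Finset.mem_univ, true_and, Finset.mem_image]
    constructor
    · intro hy
      have hyc : y = fun _ => y ⟨0, hk⟩ :=
        funext fun i => ((h.tupleMatch _ _ hy.symm).eq_iff i ⟨0, hk⟩).1 rfl
      exact ⟨y ⟨0, hk⟩, by rw [← hyc, hy], hyc.symm⟩
    · rintro ⟨w, hw, rfl⟩
      exact hw.symm
  simp only [classWeight]
  rw [← Finset.sum_filter, Finset.sum_const, nsmul_eq_mul, ← hcard, mul_inv_cancel₀ hN]

theorem sum_classWeight_const_col (h : Linked σ₁ σ₂ G H f g) (hk : 1 ≤ k) (b : V) :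
    ∑ w, classWeight f g (fun _ => w) (fun _ => b) = 1 := by
  simp only [h.classWeight_comm]
  exact h.symm.sum_classWeight_const_row hk b

/-- Double counting of the edges between two classes, where tuples are joined if they differ only in
coordinate `i` and the entries there are adjacent in `H`. -/
theorem fibreCard_mul_nbrCount (h : Linked σ₁ σ₂ G H f g) (x y : Fin k → V) (i : Fin k) :
    fibreCard g (g x) * nbrCount H g (g y) i x = fibreCard g (g y) * nbrCount H g (g x) i y := by
  classical
  let r : (Fin k → V) → (Fin k → V) → Prop :=
    fun a b => H.Adj (a i) (b i) ∧ b = Function.update a i (b i)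
  have hr : ∀ a b, r a b ↔ H.Adj (b i) (a i) ∧ a = Function.update b i (a i) := by
    intro a b
    refine and_congr (H.adj_comm _ _) ⟨fun e => ?_, fun e => ?_⟩
    · rw [e]; simp
    · rw [e]; simp
  have hcount : ∀ z c, (Finset.univ.filter fun w : Fin k → V => g w = c ∧
      (H.Adj (z i) (w i) ∧ w = Function.update z i (w i))).card = nbrCount H g c i z := by
    intro z c
    rw [nbrCount, ← Finset.card_image_of_injective _ (Function.update_injective z i)]
    congr 1
    ext w
    simp only [Finset.mem_filter, Finset.mem_univ, true_and, Finset.mem_image]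
    constructor
    · rintro ⟨hw, ha, he⟩
      exact ⟨w i, ⟨ha, by rw [← he, hw]⟩, he.symm⟩
    · rintro ⟨w, ⟨ha, hc⟩, rfl⟩
      exact ⟨hc, by simpa using ha, by simp⟩
  have hdc := Finset.sum_card_bipartiteAbove_eq_sum_card_bipartiteBelow r
    (s := Finset.univ.filter fun a => g a = g x) (t := Finset.univ.filter fun b => g b = g y)
  rw [Finset.sum_const_nat (m := nbrCount H g (g y) i x), Finset.sum_const_nat
    (m := nbrCount H g (g x) i y)] at hdc
  · exact hdc
  · intro b hb
    rw [Finset.bipartiteBelow, Finset.filter_filter]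
    simp only [hr]
    rw [hcount]
    exact (h.tupleMatch_right (Finset.mem_filter.1 hb).2).nbr i _
  · intro a ha
    rw [Finset.bipartiteAbove, Finset.filter_filter]
    rw [hcount]
    exact (h.tupleMatch_right (Finset.mem_filter.1 ha).2).nbr i _

-- Each side is a neighbour count divided by a class size. Moving `p` to a matching tuple `x` on the
-- other side makes the equality a case of `fibreCard_mul_nbrCount`.
open scoped Classical in
theorem sum_classWeight_adj (h : Linked σ₁ σ₂ G H f g) (u v : Fin k → V) (i : Fin k) (a b : V) :
    ∑ w with H.Adj b w, classWeight f g (Function.update u i a) (Function.update v i w) =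
      ∑ w with G.Adj a w, classWeight f g (Function.update u i w) (Function.update v i b) := by
  set p := Function.update u i a with hp
  set q := Function.update v i b with hq
  have h1 : ∑ w with H.Adj b w, classWeight f g p (Function.update v i w) =
      nbrCount H g (f p) i q * (fibreCard f (f p) : ℝ)⁻¹ := by
    simp only [classWeight]
    rw [← Finset.sum_filter, Finset.filter_filter, Finset.sum_const, nsmul_eq_mul, nbrCount]
    simp only [hq, Function.update_self, Function.update_idem, eq_comm (a := f p)]
  have h2 : ∑ w with G.Adj a w, classWeight f g (Function.update u i w) q =
      nbrCount G f (g q) i p * (fibreCard g (g q) : ℝ)⁻¹ := by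
    simp only [h.classWeight_comm]
    simp only [classWeight]
    rw [← Finset.sum_filter, Finset.filter_filter, Finset.sum_const, nsmul_eq_mul, nbrCount]
    simp only [hp, Function.update_self, Function.update_idem, eq_comm (a := g q)]
  obtain ⟨x, hx⟩ := h.symm.exists_left p
  rw [h1, h2, h.fibreCard_eq, ← hx, (h.tupleMatch p x hx.symm).nbr]
  have hm := h.fibreCard_mul_nbrCount x q i
  have hx0 : (fibreCard g (g x) : ℝ) ≠ 0 := by
    exact_mod_cast ((fibreCard_pos_iff g _).2 ⟨_, rfl⟩).ne'
  have hq0 : (fibreCard g (g q) : ℝ) ≠ 0 := by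
    exact_mod_cast ((fibreCard_pos_iff g _).2 ⟨_, rfl⟩).ne'
  have hm' : (fibreCard g (g x) : ℝ) * nbrCount H g (g q) i x =
      fibreCard g (g q) * nbrCount H g (g x) i q := by exact_mod_cast hm
  field_simp
  linarith

end Linked

-- Listing fewer than `k` pairs by `k` coordinates repeats one of them; a repeated coordinate can be
-- overwritten without losing a pair.
omit [Fintype V] in
theorem exists_tuple_with_spare_entry [DecidableEq V] {I : Finset (V × V)} (hne : I.Nonempty)
    (hI : I.card + 1 ≤ k) :
    ∃ (u v : Fin k → V) (i j : Fin k), i ≠ j ∧ u i = u j ∧ v i = v j ∧ pairSet u v = I ∧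
      ∀ a b, pairSet (Function.update u i a) (Function.update v i b) = insert (a, b) I := by
  obtain ⟨e⟩ : Nonempty (I ↪ Fin k) := Function.Embedding.nonempty_of_card_le (by simp; omega)
  have : Nonempty I := hne.to_subtype
  set s : Fin k → I := Function.invFun e with hs
  have hsurj : Function.Surjective s := Function.invFun_surjective e.injective
  obtain ⟨i, j, hij, hsij⟩ := Fintype.exists_ne_map_eq_of_card_lt s (by simp; omega)
  have hpair : pairSet (fun x => (s x : V × V).1) (fun x => (s x : V × V).2) = I := by
    ext p
    simp only [pairSet, Prod.mk.eta, Finset.mem_image, Finset.mem_univ, true_and]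
    exact ⟨by rintro ⟨x, rfl⟩; exact (s x).2, fun hp => (hsurj ⟨p, hp⟩).imp fun x hx => by rw [hx]⟩
  refine ⟨_, _, i, j, hij, by simp only [hsij], by simp only [hsij], hpair, fun a b => ?_⟩
  rw [pairSet_update]
  congr 1
  refine Eq.trans ?_ hpair
  refine Finset.Subset.antisymm (Finset.image_subset_image (Finset.erase_subset _ _)) ?_
  intro p hp
  obtain ⟨x, -, rfl⟩ := Finset.mem_image.1 hp
  by_cases hx : x = i
  · exact Finset.mem_image.2 ⟨j, by simp [hij.symm], by simp only [hx, hsij]⟩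
  · exact Finset.mem_image_of_mem _ (by simp [hx])

theorem Linked.isTinhoferPoint [DecidableEq V] {σ₁ σ₂ : Equiv.Perm (Fin k)} {G H : SimpleGraph V}
    {f g : (Fin k → V) → α} (h : Linked σ₁ σ₂ G H f g) (hk : 1 ≤ k)
    (hσ : Subgroup.closure {σ₁, σ₂} = ⊤) : IsTinhoferPoint k G H (classPoint f g) := by
  classical
  have hrow : ∀ I : Finset (V × V), I.card + 1 ≤ k → ∀ u,
      ∑ w, classPoint f g (insert (u, w) I) = classPoint f g I := by
    intro I hI a
    rcases I.eq_empty_or_nonempty with rfl | hne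
    · simp only [insert_empty_eq, ← pairSet_const hk, h.classPoint_pairSet hk hσ]
      exact (h.sum_classWeight_const_row hk a).trans (by simp [classPoint])
    · obtain ⟨u, v, i, j, hij, hu, hv, rfl, hins⟩ := exists_tuple_with_spare_entry hne hI
      simp only [← hins, h.classPoint_pairSet hk hσ, h.sum_classWeight_row hij hu hv]
  have hcol : ∀ I : Finset (V × V), I.card + 1 ≤ k → ∀ v,
      ∑ w, classPoint f g (insert (w, v) I) = classPoint f g I := by
    intro I hI a
    rcases I.eq_empty_or_nonempty with rfl | hne
    · simp only [insert_empty_eq, ← pairSet_const hk, h.classPoint_pairSet hk hσ]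
      exact (h.sum_classWeight_const_col hk a).trans (by simp [classPoint])
    · obtain ⟨u, v, i, j, hij, hu, hv, rfl, hins⟩ := exists_tuple_with_spare_entry hne hI
      simp only [← hins, h.classPoint_pairSet hk hσ, h.sum_classWeight_col hij hu hv]
  have hadj : ∀ I : Finset (V × V), I.Nonempty → I.card + 1 ≤ k → ∀ u v,
      ∑ w with H.Adj v w, classPoint f g (insert (u, w) I) =
        ∑ w with G.Adj u w, classPoint f g (insert (w, v) I) := by
    intro I hne hI a b
    obtain ⟨u, v, i, j, hij, hu, hv, rfl, hins⟩ := exists_tuple_with_spare_entry hne hI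
    simp only [← hins, h.classPoint_pairSet hk hσ, h.sum_classWeight_adj]
  refine ⟨by simp [classPoint], hrow, hcol, fun I hI a b => ?_, fun I hI => ?_⟩
  · rcases I.eq_empty_or_nonempty with rfl | hne
    -- The empty set has no spare-entry representation. For `k = 1` the only coordinate can be
    -- overwritten; for `k ≥ 2` each term is expanded by the row equation of `a`, which reduces to
    -- `I` a singleton.
    · rcases hk.eq_or_lt with rfl | hk2
      · have hins : ∀ x y : V, insert (x, y) (∅ : Finset (V × V)) =
            pairSet (Function.update (fun _ : Fin 1 => a) 0 x)
              (Function.update (fun _ : Fin 1 => b) 0 y) := fun x y => by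
          rw [pairSet_update]; rfl
        simp only [hins, h.classPoint_pairSet le_rfl hσ]
        exact h.sum_classWeight_adj _ _ 0 a b
      · have hext : ∀ p : V × V, classPoint f g (insert p ∅) =
            ∑ y, classPoint f g (insert p {(a, y)}) := fun p => by
          rw [insert_empty_eq, ← hrow {p} (by rw [Finset.card_singleton]; exact hk2) a]
          exact Finset.sum_congr rfl fun y _ => by rw [Finset.pair_comm]
        simp only [hext]
        rw [Finset.sum_comm, Finset.sum_comm (s := Finset.univ.filter _)]
        exact Finset.sum_congr rfl fun y _ => hadj _ (Finset.singleton_nonempty _)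
          (by rw [Finset.card_singleton]; exact hk2) a b
    · exact hadj I hne hI a b
  · unfold classPoint classWeight
    split_ifs <;> positivity

end ClassPoint

/-! ### Iteration to a fixed point. -/

section Iteration

variable {α : Type*} {F : α → α}

theorem exists_iterate_stable (m : α → ℕ) (hm : ∀ x, F x ≠ x → m (F x) < m x) (x : α) :
    ∃ r, F^[r + 1] x = F^[r] x := by
  induction h : m x using Nat.strong_induction_on generalizing x with
  | _ n ih =>
    by_cases hx : F x = x
    · exact ⟨0, hx⟩
    · obtain ⟨r, hr⟩ := ih _ (h ▸ hm x hx) (F x) rfl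
      exact ⟨r + 1, hr⟩

theorem apply_iterateUntilStable {x : α} (h : ∃ r, F^[r + 1] x = F^[r] x) :
    F (iterateUntilStable F x) = iterateUntilStable F x := by
  have := Nat.sInf_mem (s := {r : ℕ | F^[r + 1] x = F^[r] x}) h
  rwa [Set.mem_ofPred_eq, Function.iterate_succ_apply'] at this

theorem exists_iterate_eq_iterateUntilStable {x : α} (h : ∃ r, F^[r + 1] x = F^[r] x) :
    ∃ r, ∀ n ≥ r, F^[n] x = iterateUntilStable F x := by
  refine ⟨sInf {r : ℕ | F^[r + 1] x = F^[r] x}, fun n hn => ?_⟩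
  obtain ⟨d, rfl⟩ := Nat.exists_eq_add_of_le' hn
  rw [Function.iterate_add_apply]
  exact Function.iterate_fixed (apply_iterateUntilStable h) d

end Iteration

/-! ### Unordered partitions and asymmetry. -/

section Automorphism

variable {V : Type*} [Fintype V] {k : ℕ} {σ₁ σ₂ : Equiv.Perm (Fin k)} {G : SimpleGraph V}

theorem deltaEquiv_iff_tupleMatch {π : Setoid (Fin k → V)} {u v : Fin k → V} :
    deltaEquiv σ₁ σ₂ G π u v ↔
      TupleMatch σ₁ σ₂ G G (Quotient.mk π) (Quotient.mk π) u v := by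
  have hset : ∀ y, {x | π x y} = {x | Quotient.mk π x = Quotient.mk π y} := fun y => by
    ext x; exact Quotient.eq.symm
  constructor
  · rintro ⟨⟨h1, h2⟩, h3, h4, h5⟩
    have hc : ∀ i c, nbrCount G (Quotient.mk π) c i u = nbrCount G (Quotient.mk π) c i v ∧
        nonNbrCount G (Quotient.mk π) c i u = nonNbrCount G (Quotient.mk π) c i v := by
      intro i c
      induction c using Quotient.inductionOn with
      | _ y =>
        have := h2 _ (π.mem_classes y) i
        rwa [hset, ncard_nbrTuples_inter, ncard_nbrTuples_inter, ncard_nonNbrTuples_inter,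
          ncard_nonNbrTuples_inter] at this
    exact ⟨Quotient.sound h1, fun i j => (h3 i j).1, fun i j => (h3 i j).2, Quotient.sound h4,
      Quotient.sound h5, fun i c => (hc i c).1, fun i c => (hc i c).2⟩
  · intro m
    refine ⟨⟨Quotient.exact m.cell, ?_⟩, fun i j => ⟨m.eq_iff i j, m.adj_iff i j⟩,
      Quotient.exact m.perm₁, Quotient.exact m.perm₂⟩
    rintro s ⟨y, rfl⟩ i
    rw [hset, ncard_nbrTuples_inter, ncard_nbrTuples_inter, ncard_nonNbrTuples_inter,
      ncard_nonNbrTuples_inter]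
    exact ⟨m.nbr i _, m.nonNbr i _⟩

omit [Fintype V] in
theorem deltaRefine_le (π : Setoid (Fin k → V)) : deltaRefine σ₁ σ₂ G π ≤ π :=
  fun _ _ h => h.1.1

/-- The number of equivalent pairs drops strictly until the partition is stable. -/
theorem exists_deltaRefine_iterate_stable (π : Setoid (Fin k → V)) :
    ∃ r, (deltaRefine σ₁ σ₂ G)^[r + 1] π = (deltaRefine σ₁ σ₂ G)^[r] π := by
  refine exists_iterate_stable
    (fun π => {p : (Fin k → V) × (Fin k → V) | π p.1 p.2}.ncard) (fun π hne => ?_) π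
  refine Set.ncard_lt_ncard (Set.ssubset_iff_subset_ne.2
    ⟨fun p hp => deltaRefine_le π hp, fun he => hne ?_⟩) (Set.toFinite _)
  ext u v
  exact Set.ext_iff.1 he (u, v)

theorem deltaRefine_deltaStar (π : Setoid (Fin k → V)) :
    deltaRefine σ₁ σ₂ G (deltaStar σ₁ σ₂ G π) = deltaStar σ₁ σ₂ G π :=
  apply_iterateUntilStable (exists_deltaRefine_iterate_stable π)

theorem deltaEquiv_deltaStar_iff {π : Setoid (Fin k → V)} {u v : Fin k → V} :
    deltaEquiv σ₁ σ₂ G (deltaStar σ₁ σ₂ G π) u v ↔ deltaStar σ₁ σ₂ G π u v := by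
  conv_rhs => rw [← deltaRefine_deltaStar]
  rfl

omit [Fintype V] in
theorem deltaStar_le (π : Setoid (Fin k → V)) : deltaStar σ₁ σ₂ G π ≤ π :=
  Function.Iterate.rec (fun ρ => ρ ≤ π) le_rfl (fun ρ h => (deltaRefine_le ρ).trans h) _

theorem linked_deltaStar (π : Setoid (Fin k → V)) :
    Linked σ₁ σ₂ G G (Quotient.mk (deltaStar σ₁ σ₂ G π)) (Quotient.mk (deltaStar σ₁ σ₂ G π)) :=
  ⟨fun _ _ h => deltaEquiv_iff_tupleMatch.1 (deltaEquiv_deltaStar_iff.2 (Quotient.exact h)),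
    fun _ => rfl⟩

theorem classWeight_ne_zero_iff {α : Type*} {f g : (Fin k → V) → α} {u v : Fin k → V} :
    classWeight f g u v ≠ 0 ↔ f u = g v := by
  classical
  have : fibreCard f (f u) ≠ 0 := ((fibreCard_pos_iff f _).2 ⟨u, rfl⟩).ne'
  simp [classWeight, this]

variable [DecidableEq V]

theorem partitionPolytope_deltaRefine {π : Setoid (Fin k → V)} {Y : Finset (V × V) → ℝ}
    (hY : Y ∈ partitionPolytope (tinhoferExt k G G) π) :
    Y ∈ partitionPolytope (tinhoferExt k G G) (deltaRefine σ₁ σ₂ G π) := by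
  refine ⟨hY.1, fun u v huv => by_contra fun h0 => huv (deltaEquiv_iff_tupleMatch.2 ?_)⟩
  exact (mem_tinhoferExt_iff.1 hY.1).tupleMatch
    (fun u v h => hY.2 u v fun h' => h (Quotient.sound h')) σ₁ σ₂ h0

theorem combEquivDelta_tinhoferExt (hk : 1 ≤ k) (hσ : Subgroup.closure {σ₁, σ₂} = ⊤) :
    CombEquivDelta σ₁ σ₂ G (tinhoferExt k G G) := by
  intro π u v
  rw [deltaEquiv_deltaStar_iff]
  constructor
  · intro huv Y hY
    have : Y ∈ partitionPolytope (tinhoferExt k G G) (deltaStar σ₁ σ₂ G π) :=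
      Function.Iterate.rec (fun ρ => Y ∈ partitionPolytope (tinhoferExt k G G) ρ)
        hY (fun ρ h => partitionPolytope_deltaRefine h) _
    exact this.2 u v huv
  · intro h huv
    have hl := linked_deltaStar (σ₁ := σ₁) (σ₂ := σ₂) (G := G) π
    refine classWeight_ne_zero_iff.2 (Quotient.sound huv)
      ((hl.classPoint_pairSet hk hσ u v).symm.trans (h _ ⟨?_, fun x y hxy => ?_⟩))
    · exact mem_tinhoferExt_iff.2 (hl.isTinhoferPoint hk hσ)
    · rw [hl.classPoint_pairSet hk hσ]
      exact not_not.1 fun h0 => hxy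
        (deltaStar_le π (Quotient.exact (classWeight_ne_zero_iff.1 h0)))

theorem tinhoferSA_eq_singleton_iff (hk : 1 ≤ k) (hσ : Subgroup.closure {σ₁, σ₂} = ⊤) :
    tinhoferSA k G G = {(1 : Matrix V V ℝ)} ↔ DeclaresAsymmetric σ₁ σ₂ G := by
  have hcomb := combEquivDelta_tinhoferExt (G := G) hk hσ ⊤
  simp only [deltaEquiv_deltaStar_iff] at hcomb
  constructor
  · intro hT
    -- Two distinct equivalent tuples would give a point with `Y (pairSet u v) ≠ 0`, hence, by
    -- monotonicity, a nonzero off-diagonal entry at a coordinate where they differ.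
    refine le_bot_iff.1 fun u v huv => by_contra fun hne : ¬ u = v => ?_
    have := mt (hcomb u v).2 (not_not.2 huv)
    push Not at this
    obtain ⟨Y, hY, h0⟩ := this
    obtain ⟨i, hi⟩ := Function.ne_iff.1 hne
    have hmem : Matrix.of (fun a b => Y {(a, b)}) ∈ tinhoferSA k G G :=
      ⟨Y, hY.1, fun _ => rfl⟩
    rw [hT, Set.mem_singleton_iff] at hmem
    refine (mem_tinhoferExt_iff.1 hY.1).ne_zero_of_subset
      (Finset.singleton_subset_iff.2 (mem_pairSet u v i)) (card_pairSet_le u v) h0 ?_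
    exact (congrFun (congrFun hmem (u i)) (v i)).trans (Matrix.one_apply_ne hi)
  · intro hbot
    have hone : ∀ Y ∈ tinhoferExt k G G, ∀ M : Matrix V V ℝ,
        (∀ p : V × V, M p.1 p.2 = Y {p}) → M = 1 := by
      intro Y hY M hM
      have hoff : ∀ a b, a ≠ b → Y {(a, b)} = 0 := by
        intro a b hab
        rw [← pairSet_const hk]
        refine (hcomb _ _).1 (fun h => hab ?_) Y ⟨hY, fun u v h => absurd trivial h⟩
        rw [show deltaStar σ₁ σ₂ G ⊤ = ⊥ from hbot] at h
        exact congrFun h ⟨0, hk⟩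
      have hP := mem_tinhoferExt_iff.1 hY
      ext a b
      rw [hM (a, b)]
      by_cases hab : a = b
      · subst hab
        rw [Matrix.one_apply_eq, ← hP.one, ← hP.row ∅ (by simpa using hk) a]
        exact (Finset.sum_eq_single a (fun w _ hw => hoff a w hw.symm) (by simp)).symm
      · rw [Matrix.one_apply_ne hab, hoff a b hab]
    -- The class point of the stable partition shows that the relaxation is nonempty; `hone`
    -- identifies its projection with the identity.
    have hl := linked_deltaStar (σ₁ := σ₁) (σ₂ := σ₂) (G := G) ⊤
    have hP := mem_tinhoferExt_iff.2 (hl.isTinhoferPoint hk hσ)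
    refine Set.Subset.antisymm (fun M ⟨Y, hY, hM⟩ => hone Y hY M hM) ?_
    rw [Set.singleton_subset_iff]
    refine ⟨_, hP, fun p => ?_⟩
    rw [← hone _ hP (Matrix.of fun a b => classPoint _ _ {(a, b)}) fun _ => rfl]
    rfl

end Automorphism

/-! ### Ordered partitions and ranks of keys. -/

namespace OrdPartition

variable {T : Type*}

/-- Indices fill an initial segment of `ℕ`, so the order alone determines them. -/
theorem ext_of_lt_iff {π ρ : OrdPartition T}
    (h : ∀ u v, π.index u < π.index v ↔ ρ.index u < ρ.index v) : π = ρ := by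
  have key : ∀ n u, π.index u = n → ρ.index u = n := by
    intro n
    induction n using Nat.strong_induction_on with
    | _ n ih =>
      intro u hu
      rcases lt_trichotomy (ρ.index u) n with hlt | he | hgt
      · obtain ⟨v, hv⟩ := π.initial u (ρ.index u) (hu ▸ hlt)
        have h1 := (h v u).1 (by omega)
        have h2 := ih _ hlt v hv
        omega
      · exact he
      · obtain ⟨v, hv⟩ := ρ.initial u n hgt
        have h1 := (h v u).2 (by omega)
        have h2 := ih _ (hu ▸ h1) v rfl
        omega
  ext u
  exact (key _ u rfl).symm

theorem index_lt_size [Finite T] (π : OrdPartition T) (u : T) : π.index u < π.size := by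
  have hsub : (Set.Iic (π.index u)) ⊆ Set.range π.index := by
    intro j hj
    rcases (Set.mem_Iic.1 hj).eq_or_lt with rfl | hlt
    · exact ⟨u, rfl⟩
    · exact π.initial u j hlt
  have := Set.ncard_le_ncard hsub (Set.finite_range _)
  rw [← Finset.coe_Iic, Set.ncard_coe_finset, Nat.card_Iic] at this
  exact this

theorem rank_lt_rank {K : Type*} [LinearOrder K] {S : Finset K} {a b : K} (ha : a ∈ S)
    (hab : a < b) : {x ∈ S | x < a}.card < {x ∈ S | x < b}.card := by
  refine Finset.card_lt_card (Finset.ssubset_iff_of_subset (fun x hx => ?_) |>.2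
    ⟨a, Finset.mem_filter.2 ⟨ha, hab⟩, fun h => lt_irrefl _ (Finset.mem_filter.1 h).2⟩)
  rw [Finset.mem_filter] at hx ⊢
  exact ⟨hx.1, hx.2.trans hab⟩

theorem rank_eq_rank_iff {K : Type*} [LinearOrder K] {S : Finset K} {a b : K} (ha : a ∈ S)
    (hb : b ∈ S) : {x ∈ S | x < a}.card = {x ∈ S | x < b}.card ↔ a = b := by
  refine ⟨fun h => ?_, fun h => by rw [h]⟩
  rcases lt_trichotomy a b with hlt | he | hgt
  · exact absurd h (rank_lt_rank ha hlt).ne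
  · exact he
  · exact absurd h (rank_lt_rank hb hgt).ne'

theorem ofKey_index_lt_iff [Fintype T] {K : Type*} [LinearOrder K] (f : T → K) (u v : T) :
    (ofKey f).index u < (ofKey f).index v ↔ f u < f v := by
  refine ⟨fun h => lt_of_not_ge fun hle => h.not_ge ?_,
    rank_lt_rank (Finset.mem_image_of_mem f (Finset.mem_univ u))⟩
  rcases hle.eq_or_lt with he | hlt
  · simp only [ofKey, he, le_refl]
  · exact (rank_lt_rank (Finset.mem_image_of_mem f (Finset.mem_univ v)) hlt).le

theorem ofKey_index_eq_iff [Fintype T] {K : Type*} [LinearOrder K] {f g : T → K}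
    (h : Finset.univ.image f = Finset.univ.image g) (u v : T) :
    (ofKey f).index u = (ofKey g).index v ↔ f u = g v := by
  simp only [ofKey]
  rw [← h]
  exact rank_eq_rank_iff (Finset.mem_image_of_mem f (Finset.mem_univ u))
    (h ▸ Finset.mem_image_of_mem g (Finset.mem_univ v))

end OrdPartition

/-! ### Ordered partitions and non-isomorphism. -/

section Isomorphism

variable {V : Type*} {k : ℕ} {σ₁ σ₂ : Equiv.Perm (Fin k)} {G H : SimpleGraph V}
  {π τ : OrdPartition (Fin k → V)}

theorem ordDeltaEquiv_iff {u v : Fin k → V} :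
    OrdDeltaEquiv σ₁ σ₂ G π u H τ v ↔ deltaKey σ₁ σ₂ G π u = deltaKey σ₁ σ₂ H τ v :=
  antisymm_iff

theorem typeEntry_eq_iff {a b c d : V} :
    typeEntry G a b = typeEntry H c d ↔ (a = b ↔ c = d) ∧ (G.Adj a b ↔ H.Adj c d) := by
  have h1 := fun h : G.Adj a b => h.ne
  have h2 := fun h : H.Adj c d => h.ne
  unfold typeEntry
  split_ifs <;> simp_all

variable [Fintype V]

theorem nbrCount_index_eq_zero {c : ℕ} (hc : π.size ≤ c) (i : Fin k) (u : Fin k → V) :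
    nbrCount G π.index c i u = 0 ∧ nonNbrCount G π.index c i u = 0 := by
  have : ∀ x, π.index x ≠ c := fun x => ((π.index_lt_size x).trans_le hc).ne
  simp [nbrCount, nonNbrCount, this]

theorem degreeVector_eq (i : Fin k) (u : Fin k → V) :
    degreeVector G π i u = (List.range π.size).map (fun s => nbrCount G π.index s i u) ++
      (List.range π.size).map (fun s => nonNbrCount G π.index s i u) := by
  simp only [← ncard_nbrTuples_inter, ← ncard_nonNbrTuples_inter]
  rfl

theorem tupleMatch_of_deltaKey_eq (hk : 1 ≤ k) {u v : Fin k → V}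
    (h : deltaKey σ₁ σ₂ G π u = deltaKey σ₁ σ₂ H τ v) :
    TupleMatch σ₁ σ₂ G H π.index τ.index u v := by
  have h1 : π.index u = τ.index v := congrArg (fun x : DeltaKey k => (ofLex x).1) h
  have h2 : π.index (u ∘ σ₁) = τ.index (v ∘ σ₁) :=
    congrArg (fun x : DeltaKey k => (ofLex (ofLex (ofLex x).2).1).1) h
  have h3 : π.index (u ∘ σ₂) = τ.index (v ∘ σ₂) :=
    congrArg (fun x : DeltaKey k => (ofLex (ofLex (ofLex x).2).1).2) h
  have h4 : ∀ i j, typeEntry G (u i) (u j) = typeEntry H (v i) (v j) := fun i j =>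
    congrArg (fun x : DeltaKey k =>
      ofLex (ofLex (ofLex (ofLex (ofLex x).2).2).1 i) j) h
  have h5 : ∀ i, degreeVector G π i u = degreeVector H τ i v := fun i =>
    congrArg (fun x : DeltaKey k => ofLex (ofLex (ofLex (ofLex x).2).2).2 i) h
  -- A degree vector has length twice the number of cells, so one coordinate, present as `1 ≤ k`,
  -- fixes that number.
  have hsize : π.size = τ.size := by
    have := congrArg List.length (h5 ⟨0, hk⟩)
    simp only [degreeVector, List.length_append, List.length_map, List.length_range] at this
    omega
  have hc : ∀ i c, nbrCount G π.index c i u = nbrCount H τ.index c i v ∧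
      nonNbrCount G π.index c i u = nonNbrCount H τ.index c i v := by
    intro i c
    by_cases hlt : c < π.size
    · have h6 := h5 i
      rw [degreeVector_eq, degreeVector_eq, ← hsize] at h6
      obtain ⟨h7, h8⟩ := List.append_inj h6 (by simp)
      exact ⟨List.map_inj_left.1 h7 c (List.mem_range.2 hlt),
        List.map_inj_left.1 h8 c (List.mem_range.2 hlt)⟩
    · have h6 := nbrCount_index_eq_zero (G := G) (not_lt.1 hlt) i u
      have h7 := nbrCount_index_eq_zero (G := H) (π := τ) (hsize ▸ not_lt.1 hlt) i v
      rw [h6.1, h6.2, h7.1, h7.2]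
      exact ⟨rfl, rfl⟩
  exact ⟨h1, fun i j => (typeEntry_eq_iff.1 (h4 i j)).1, fun i j => (typeEntry_eq_iff.1 (h4 i j)).2,
    h2, h3, fun i c => (hc i c).1, fun i c => (hc i c).2⟩

theorem TupleMatch.deltaKey_eq {u v : Fin k → V} (hsize : π.size = τ.size)
    (m : TupleMatch σ₁ σ₂ G H π.index τ.index u v) :
    deltaKey σ₁ σ₂ G π u = deltaKey σ₁ σ₂ H τ v := by
  have h4 : ∀ i j, typeEntry G (u i) (u j) = typeEntry H (v i) (v j) := fun i j =>
    typeEntry_eq_iff.2 ⟨m.eq_iff i j, m.adj_iff i j⟩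
  have h5 : ∀ i, degreeVector G π i u = degreeVector H τ i v := fun i => by
    simp only [degreeVector_eq, hsize, m.nbr, m.nonNbr]
  simp only [deltaKey, m.cell, m.perm₁, m.perm₂, h4, h5]

theorem ordDeltaRefine_index_lt {u v : Fin k → V} (h : π.index u < π.index v) :
    (ordDeltaRefine σ₁ σ₂ G π).index u < (ordDeltaRefine σ₁ σ₂ G π).index v :=
  (OrdPartition.ofKey_index_lt_iff _ u v).2 (Prod.Lex.toLex_lt_toLex.2 (Or.inl h))

theorem index_eq_of_ordDeltaRefine_index_eq {u v : Fin k → V}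
    (h : (ordDeltaRefine σ₁ σ₂ G π).index u = (ordDeltaRefine σ₁ σ₂ G π).index v) :
    π.index u = π.index v := by
  rcases lt_trichotomy (π.index u) (π.index v) with hlt | he | hgt
  · exact absurd h (ordDeltaRefine_index_lt hlt).ne
  · exact he
  · exact absurd h (ordDeltaRefine_index_lt hgt).ne'

theorem exists_ordDeltaRefine_iterate_stable (π : OrdPartition (Fin k → V)) :
    ∃ r, (ordDeltaRefine σ₁ σ₂ G)^[r + 1] π = (ordDeltaRefine σ₁ σ₂ G)^[r] π := by
  refine exists_iterate_stable
    (fun π => {p : (Fin k → V) × (Fin k → V) | π.index p.1 = π.index p.2}.ncard)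
    (fun π hne => ?_) π
  refine Set.ncard_lt_ncard (Set.ssubset_iff_subset_ne.2
    ⟨fun p hp => index_eq_of_ordDeltaRefine_index_eq hp, fun he => hne ?_⟩) (Set.toFinite _)
  -- If no cell splits, the order is also unchanged: the old index is the leading component of the
  -- key.
  refine OrdPartition.ext_of_lt_iff fun u v => ⟨fun h => ?_, ordDeltaRefine_index_lt⟩
  rcases lt_trichotomy (π.index u) (π.index v) with hlt | heq | hgt
  · exact hlt
  · exact absurd ((Set.ext_iff.1 he (u, v)).2 heq) h.ne
  · exact absurd (ordDeltaRefine_index_lt hgt) h.asymm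

theorem ordDeltaRefine_ordDeltaStar (π : OrdPartition (Fin k → V)) :
    ordDeltaRefine σ₁ σ₂ G (ordDeltaStar σ₁ σ₂ G π) = ordDeltaStar σ₁ σ₂ G π :=
  apply_iterateUntilStable (exists_ordDeltaRefine_iterate_stable π)

theorem OrdDeltaStableEquiv.linked (hk : 1 ≤ k) (h : OrdDeltaStableEquiv σ₁ σ₂ G π H τ) :
    Linked σ₁ σ₂ G H π.index τ.index := by
  obtain ⟨hπ, hτ, hs, he⟩ := h
  rw [hπ, hτ] at hs he
  refine ⟨fun u v huv => tupleMatch_of_deltaKey_eq hk (ordDeltaEquiv_iff.1 ((he u v).2 huv)),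
    fun c => ?_⟩
  have hcard : ∀ ρ : OrdPartition (Fin k → V), fibreCard ρ.index c = (ρ.cell c).ncard := fun ρ => by
    rw [fibreCard, ← Set.ncard_coe_finset]
    congr 1
    ext; simp [OrdPartition.cell]
  by_cases hc : c < π.size
  · rw [hcard, hcard, hs.2 c hc]
  · have h0 : ∀ ρ : OrdPartition (Fin k → V), ρ.size ≤ c → fibreCard ρ.index c = 0 := fun ρ hρ =>
      not_not.1 fun hne => by
        obtain ⟨u, hu⟩ := (fibreCard_pos_iff _ _).1 (Nat.pos_of_ne_zero hne)
        have := ρ.index_lt_size u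
        omega
    rw [h0 π (by omega), h0 τ (by have := hs.1; omega)]

variable [DecidableEq V] {Y : Finset (V × V) → ℝ}

/-- `Y` is doubly stochastic on tuples and supported on pairs with equal index. -/
theorem sameShape_of_mem_ordPartitionPolytope
    (hY : Y ∈ ordPartitionPolytope (tinhoferExt k G H) π τ) : π.SameShape τ := by
  classical
  have hP := mem_tinhoferExt_iff.1 hY.1
  have hidx : ∀ u v, Y (pairSet u v) ≠ 0 → π.index u = τ.index v := fun u v h0 =>
    not_not.1 fun h => h0 (hY.2 u v h)
  refine ⟨?_, fun s _ => ?_⟩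
  · unfold OrdPartition.size
    congr 1
    ext n
    constructor
    · rintro ⟨u, rfl⟩
      obtain ⟨v, hv⟩ := hP.exists_right u
      exact ⟨v, (hidx u v hv).symm⟩
    · rintro ⟨v, rfl⟩
      obtain ⟨u, hu⟩ := hP.exists_left v
      exact ⟨u, hidx u v hu⟩
  · have := card_eq_of_doublyStochastic (M := fun u v : Fin k → V => Y (pairSet u v)) one_ne_zero
      hP.sum_pairSet hP.sum_pairSet' (p := fun u => π.index u = s) (q := fun v => τ.index v = s)
      (fun u v h0 => by rw [hidx u v h0])
    rw [← Set.ncard_coe_finset, ← Set.ncard_coe_finset] at this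
    simpa [OrdPartition.cell] using this

theorem deltaKey_eq_of_mem_ordPartitionPolytope
    (hY : Y ∈ ordPartitionPolytope (tinhoferExt k G H) π τ) {u v : Fin k → V}
    (h0 : Y (pairSet u v) ≠ 0) : deltaKey σ₁ σ₂ G π u = deltaKey σ₁ σ₂ H τ v :=
  ((mem_tinhoferExt_iff.1 hY.1).tupleMatch hY.2 σ₁ σ₂ h0).deltaKey_eq
    (sameShape_of_mem_ordPartitionPolytope hY).1

/-- New indices are ranks among the attained keys. Every tuple has a partner of nonzero weight with
the same key, so both sides attain the same keys and their ranks are comparable. -/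
theorem ordDeltaRefine_index_eq_iff_of_mem (σ₁ σ₂ : Equiv.Perm (Fin k))
    (hY : Y ∈ ordPartitionPolytope (tinhoferExt k G H) π τ) (u v : Fin k → V) :
    (ordDeltaRefine σ₁ σ₂ G π).index u = (ordDeltaRefine σ₁ σ₂ H τ).index v ↔
      deltaKey σ₁ σ₂ G π u = deltaKey σ₁ σ₂ H τ v := by
  have hP := mem_tinhoferExt_iff.1 hY.1
  refine OrdPartition.ofKey_index_eq_iff ?_ u v
  ext x
  simp only [Finset.mem_image, Finset.mem_univ, true_and]
  constructor
  · rintro ⟨u, rfl⟩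
    obtain ⟨v, hv⟩ := hP.exists_right u
    exact ⟨v, (deltaKey_eq_of_mem_ordPartitionPolytope hY hv).symm⟩
  · rintro ⟨v, rfl⟩
    obtain ⟨u, hu⟩ := hP.exists_left v
    exact ⟨u, deltaKey_eq_of_mem_ordPartitionPolytope hY hu⟩

theorem ordPartitionPolytope_ordDeltaRefine
    (hY : Y ∈ ordPartitionPolytope (tinhoferExt k G H) π τ) :
    Y ∈ ordPartitionPolytope (tinhoferExt k G H) (ordDeltaRefine σ₁ σ₂ G π)
      (ordDeltaRefine σ₁ σ₂ H τ) :=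
  ⟨hY.1, fun u v huv => not_not.1 fun h0 => huv <|
    (ordDeltaRefine_index_eq_iff_of_mem σ₁ σ₂ hY u v).2
      (deltaKey_eq_of_mem_ordPartitionPolytope hY h0)⟩

theorem ordDeltaGraphEquiv_of_mem (hY : Y ∈ ordPartitionPolytope (tinhoferExt k G H) π τ) :
    OrdDeltaGraphEquiv σ₁ σ₂ G π H τ :=
  ⟨sameShape_of_mem_ordPartitionPolytope (ordPartitionPolytope_ordDeltaRefine hY), fun u v =>
    ordDeltaEquiv_iff.trans (ordDeltaRefine_index_eq_iff_of_mem σ₁ σ₂ hY u v).symm⟩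

theorem combEquivOrdDelta_tinhoferExt (hk : 1 ≤ k) (hσ : Subgroup.closure {σ₁, σ₂} = ⊤) :
    CombEquivOrdDelta σ₁ σ₂ G H (tinhoferExt k G H) := by
  intro π τ
  refine ⟨fun u v huv Y hY => not_not.1 fun h0 => huv (ordDeltaEquiv_iff.2
    (deltaKey_eq_of_mem_ordPartitionPolytope hY h0)), fun h => ?_⟩
  have hl := h.linked hk
  have hmem : classPoint π.index τ.index ∈ ordPartitionPolytope (tinhoferExt k G H) π τ :=
    ⟨mem_tinhoferExt_iff.2 (hl.isTinhoferPoint hk hσ), fun u v huv => by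
      rw [hl.classPoint_pairSet hk hσ]
      exact not_not.1 fun h0 => huv (classWeight_ne_zero_iff.1 h0)⟩
  refine ⟨⟨_, hmem⟩, fun u v huv => ⟨_, hmem, ?_⟩⟩
  rw [hl.classPoint_pairSet hk hσ, classWeight_ne_zero_iff]
  exact (tupleMatch_of_deltaKey_eq hk (ordDeltaEquiv_iff.1 huv)).cell

theorem tinhoferSA_eq_empty_iff (hk : 1 ≤ k) (hσ : Subgroup.closure {σ₁, σ₂} = ⊤) :
    tinhoferSA k G H = ∅ ↔ DeclaresNonIsomorphic σ₁ σ₂ G H := by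
  rw [← not_iff_not, DeclaresNonIsomorphic, not_not, ← ne_eq, ← Set.nonempty_iff_ne_empty]
  constructor
  · rintro ⟨M, Y, hY, -⟩
    have hmem : ∀ n, Y ∈ ordPartitionPolytope (tinhoferExt k G H)
        ((ordDeltaRefine σ₁ σ₂ G)^[n] (OrdPartition.trivial _))
        ((ordDeltaRefine σ₁ σ₂ H)^[n] (OrdPartition.trivial _)) := by
      intro n
      induction n with
      | zero => exact ⟨hY, fun u v h => absurd rfl h⟩
      | succ n ih =>
        rw [Function.iterate_succ_apply', Function.iterate_succ_apply']
        exact ordPartitionPolytope_ordDeltaRefine ih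
    -- The two refinements may stabilise at different times, so a common later iterate is used.
    obtain ⟨r, hr⟩ := exists_iterate_eq_iterateUntilStable
      (exists_ordDeltaRefine_iterate_stable (σ₁ := σ₁) (σ₂ := σ₂) (G := G)
        (OrdPartition.trivial (Fin k → V)))
    obtain ⟨s, hs⟩ := exists_iterate_eq_iterateUntilStable
      (exists_ordDeltaRefine_iterate_stable (σ₁ := σ₁) (σ₂ := σ₂) (G := H)
        (OrdPartition.trivial (Fin k → V)))
    have h := hmem (max r s)
    rw [hr _ (le_max_left r s), hs _ (le_max_right r s)] at h
    exact ordDeltaGraphEquiv_of_mem h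
  · intro h
    obtain ⟨⟨Y, hY⟩, -⟩ := (combEquivOrdDelta_tinhoferExt (G := G) (H := H) hk hσ _ _).2
      ⟨ordDeltaRefine_ordDeltaStar _, ordDeltaRefine_ordDeltaStar _, h⟩
    exact ⟨fun a b => Y {(a, b)}, Y, hY.1, fun _ => rfl⟩

end Isomorphism

theorem theorem1 {V : Type*} [Fintype V] [DecidableEq V] (k : ℕ) (hk : 1 ≤ k)
    (σ₁ σ₂ : Equiv.Perm (Fin k)) (hσ : Subgroup.closure {σ₁, σ₂} = ⊤) (G H : SimpleGraph V) :
    (tinhoferSA k G G = {(1 : Matrix V V ℝ)} ↔ DeclaresAsymmetric σ₁ σ₂ G) ∧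
    (tinhoferSA k G H = ∅ ↔ DeclaresNonIsomorphic σ₁ σ₂ G H) ∧
    CombEquivDelta σ₁ σ₂ G (tinhoferExt k G G) ∧
    CombEquivOrdDelta σ₁ σ₂ G H (tinhoferExt k G H) :=
  ⟨tinhoferSA_eq_singleton_iff hk hσ, tinhoferSA_eq_empty_iff hk hσ,
    combEquivDelta_tinhoferExt hk hσ, combEquivOrdDelta_tinhoferExt hk hσ⟩
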